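/- Let $0<\alpha<1$ be irrational. Let $R_\alpha:[0,1)\to[0,1)$, $R_\alpha(t)=t+\alpha \pmod 1$, and let $I_\alpha:[0,1)\to\{0,1\}$ be $0$ on $[0,1-\alpha)$ and $1$ on $[1-\alpha,1)$. The Sturmian subshift $(\Omega_\alpha,S)$ generated by $\alpha$ is the closure $\Omega_\alpha\subset\{0,1\}^{\mathbb Z}$ (product topology) of $\{(I_\alpha(R_\alpha^n(t)))_{n\in\mathbb Z} : t\in[0,1)\}$ with the shift $(Sx)_n=x_{n+1}$. It is uniquely ergodic; let $\mu$ be its unique invariant probability measure, which is ergodic. Let $\zeta=\{[0],[1]\}$, where $[a]=\{x\in\Omega_\alpha : x_0=a\}$. For a map $T:X\to X$, a finite partition $\zeta$ of $X$ and $x\in X$, let $\zeta_n(x)$ be the atom containing $x$ of $\zeta_n=\zeta\vee T^{-1}\zeta\vee\dots\vee T^{-n+1}\zeta$. For $U\subset X$ let $\tau(U)=\inf\{k\ge 1 : T^k y\in U \text{ for some } y\in U\}$ (with $\inf\emptyset=\infty$), and let $$\underline{R}_\zeta(x)=\liminf_{n\to\infty}\frac{\tau(\zeta_n(x))}{n},\qquad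 \overline{R}_\zeta(x)=\limsup_{n\to\infty}\frac{\tau(\zeta_n(x))}{n},$$ with values in $[0,\infty]$. 1. The following are equivalent: (a) the coefficients of the continued fraction of $\alpha$ are bounded; (b) $\underline{R}_\zeta(x)>0$ for $\mu$-almost every $x$; (c) $\overline{R}_\zeta(x)<\infty$ for $\mu$-almost every $x$. 2. If the coefficients of the continued fraction of $\alpha$ are bounded, then $\underline{R}_\zeta(x)<1$ and $\overline{R}_\zeta(x)>1$ for $\mu$-almost every $x$. 3. Statements 1 and 2 also hold with $(\Omega_\alpha,S,\mu)$ replaced by $([0,1),R_\alpha,\text{Lebesgue measure})$ and $\zeta$ by $\{[0,1-\alpha),[1-\alpha,1)\}$. -/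

import Mathlib

open MeasureTheory Filter Set
open scoped ENNReal

namespace Recurrence

noncomputable section

variable {X : Type*}

/-- First return time `τ_U(x) = inf {k ≥ 1 : T^k x ∈ U}`, equal to `⊤` if there is no return. -/
def returnTime (T : X → X) (U : Set X) (x : X) : ℕ∞ :=
  ⨅ k ∈ {k : ℕ | 1 ≤ k ∧ T^[k] x ∈ U}, (k : ℕ∞)

/-- Poincaré recurrence of a set, `τ(U) = inf {τ_U(x) : x ∈ U}`. -/
def setRecurrence (T : X → X) (U : Set X) : ℕ∞ :=
  ⨅ x ∈ U, returnTime T U x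

/-- The partition `ζ_n = ζ ∨ T⁻¹ζ ∨ ⋯ ∨ T^{-(n-1)}ζ`. A partition is given by the set of its
atoms; `ζ_0` is the trivial partition. -/
def iteratedPartition (T : X → X) (ζ : Set (Set X)) (n : ℕ) : Set (Set X) :=
  {B | B.Nonempty ∧ ∃ A : Fin n → Set X, (∀ i, A i ∈ ζ) ∧ B = ⋂ i : Fin n, T^[i] ⁻¹' A i}

/-- The atom of the partition `ζ` that contains `x`. -/
def atomOf (ζ : Set (Set X)) (x : X) : Set X :=
  ⋃₀ {A | A ∈ ζ ∧ x ∈ A}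

/-- The lower local rate of Poincaré recurrence, `liminf τ(ζ_n(x)) / n`. -/
def lowerRate (T : X → X) (ζ : Set (Set X)) (x : X) : ℝ≥0∞ :=
  liminf (fun n : ℕ =>
    (setRecurrence T (atomOf (iteratedPartition T ζ n) x) : ℝ≥0∞) / (n : ℝ≥0∞)) atTop

/-- The upper local rate of Poincaré recurrence, `limsup τ(ζ_n(x)) / n`. -/
def upperRate (T : X → X) (ζ : Set (Set X)) (x : X) : ℝ≥0∞ :=
  limsup (fun n : ℕ =>
    (setRecurrence T (atomOf (iteratedPartition T ζ n) x) : ℝ≥0∞) / (n : ℝ≥0∞)) atTop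

/-- `μ` is the unique `T`-invariant probability measure, and it is ergodic. -/
def IsUniqueErgodicMeasure [MeasurableSpace X] (T : X → X) (μ : Measure X) : Prop :=
  IsProbabilityMeasure μ ∧ Ergodic T μ ∧
    ∀ ν : Measure X, IsProbabilityMeasure ν → MeasurePreserving T ν ν → ν = μ

/-- The interval `[0,1)`. -/
abbrev UnitIco : Type := Ico (0 : ℝ) 1

/-- Lebesgue measure on `[0,1)`. -/
def lebesgueIco : Measure UnitIco := (volume : Measure ℝ).comap (Subtype.val : UnitIco → ℝ)

/-- The rotation `t ↦ t + α (mod 1)` of `[0,1)`, as a bijection, so that it has integer powers. -/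
def rotation (α : ℝ) : Equiv.Perm UnitIco where
  toFun t := ⟨Int.fract ((t : ℝ) + α), Int.fract_nonneg _, Int.fract_lt_one _⟩
  invFun t := ⟨Int.fract ((t : ℝ) - α), Int.fract_nonneg _, Int.fract_lt_one _⟩
  left_inv t := by
    apply Subtype.ext
    change Int.fract (Int.fract ((t : ℝ) + α) - α) = t
    rw [Int.fract_eq_iff]
    refine ⟨t.2.1, t.2.2, -⌊(t : ℝ) + α⌋, ?_⟩
    rw [Int.fract]
    push_cast
    ring
  right_inv t := by
    apply Subtype.ext
    change Int.fract (Int.fract ((t : ℝ) - α) + α) = t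
    rw [Int.fract_eq_iff]
    refine ⟨t.2.1, t.2.2, -⌊(t : ℝ) - α⌋, ?_⟩
    rw [Int.fract]
    push_cast
    ring

/-- `I_α(t) = 0` if `t ∈ [0, 1-α)`, and `1` otherwise. -/
def letter (α : ℝ) (t : UnitIco) : Fin 2 :=
  if (t : ℝ) < 1 - α then 0 else 1

/-- The two-sided sequence `(I_α(R_α^n(t)))_{n ∈ ℤ}`. -/
def coding (α : ℝ) (t : UnitIco) : ℤ → Fin 2 :=
  fun n => letter α ((rotation α ^ n) t)

/-- The shift map on two-sided sequences. -/
def shift (x : ℤ → Fin 2) : ℤ → Fin 2 := fun n => x (n + 1)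

/-- `Ω_α`, the closure (in the product topology) of the set of all codings. -/
def sturmianSet (α : ℝ) : Set (ℤ → Fin 2) := closure (range (coding α))

theorem continuous_shift : Continuous shift :=
  continuous_pi fun n => continuous_apply (n + 1)

theorem shift_coding (α : ℝ) (t : UnitIco) :
    shift (coding α t) = coding α (rotation α t) := by
  funext n
  simp only [shift, coding, zpow_add, zpow_one, Equiv.Perm.mul_apply]

theorem mapsTo_shift (α : ℝ) : MapsTo shift (sturmianSet α) (sturmianSet α) := by
  refine MapsTo.closure ?_ continuous_shift
  rintro _ ⟨t, rfl⟩
  exact ⟨rotation α t, (shift_coding α t).symm⟩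

/-- The shift map `S` on the Sturmian subshift `Ω_α`. -/
def sturmianShift (α : ℝ) : sturmianSet α → sturmianSet α :=
  (mapsTo_shift α).restrict shift (sturmianSet α) (sturmianSet α)

/-- The partition `{[0], [1]}` of `Ω_α`. -/
def sturmianPartition (α : ℝ) : Set (Set (sturmianSet α)) :=
  {{x : sturmianSet α | (x : ℤ → Fin 2) 0 = 0}, {x : sturmianSet α | (x : ℤ → Fin 2) 0 = 1}}

/-- The partition `{[0, 1-α), [1-α, 1)}` of `[0,1)`. -/
def rotationPartition (α : ℝ) : Set (Set UnitIco) :=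
  {{t : UnitIco | (t : ℝ) ∈ Ico 0 (1 - α)}, {t : UnitIco | (t : ℝ) ∈ Ico (1 - α) 1}}

/-- The coefficients `a_1, a_2, …` of the continued fraction of `α` are bounded. -/
def BoundedCoefficients (α : ℝ) : Prop :=
  ∃ C : ℝ, ∀ (n : ℕ) (a : ℝ), (GenContFract.of α).partDens.get? n = some a → a ≤ C

end

end Recurrence

/-! Everything is read off from the distances ‖kα‖ to the nearest integer. Bounded coefficients mean
that k‖kα‖ is bounded below (`boundedCoefficients_iff`; one direction uses Legendre's theorem on
convergents). The atoms of level n are intervals, cut by the backward orbit of 0, and τ is the least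
k for which translation by kα returns some point of the atom to it. If α is badly approximable,
every atom has length comparable to 1/n, so τ is comparable to n at every point
(`lower_bound_of_badlyApproximable`, `upper_bound_of_badlyApproximable`).

The other estimates rest on `crossingArc`, an arc of length ‖qα‖ at 0 off which the q-th iterate of
the rotation is a genuine translation of reals. If the orbit of t avoids the arc up to time n, then
t and its q-th image read the same word, so τ ≤ q. If the orbit meets the arc by time n - q and q'
is the best approximation denominator after q, then τ ≥ q' (`IsConsecutive.le_wordRecurrence`). The
measures of these events follow from a union bound and from disjointness of preimages of the arc.
Taking n slightly above q, with q'/q bounded away from 1, gives lower rates below 1 and, for badly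
approximable α, upper rates above 1. If α is not badly approximable, q‖qα‖ can be made arbitrarily
small and the same events force rates 0 and ∞.

Such estimates give positive measure for infinitely many n. Since τ at level n of Tx is at most τ at
level n + 1 of x, the rates do not increase along orbits, and ergodicity turns positive measure into
full measure (`ae_le_limsup_div`, `ae_liminf_div_le`).

Results pass to the subshift because τ depends only on a word and the codings are dense. Its measure
is the image of Lebesgue measure; uniqueness comes from averaging a cylinder over times k with kα
evenly spread mod 1 (`measure_itinerary_le`). -/

namespace Recurrence

/-! ### Bounded continued fraction coefficients and bad approximability. -/

/-- The distance from `x` to the nearest integer. -/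
noncomputable def nearestDist (x : ℝ) : ℝ := |x - round x|

theorem nearestDist_nonneg (x : ℝ) : 0 ≤ nearestDist x := abs_nonneg _

theorem nearestDist_le (x : ℝ) (m : ℤ) : nearestDist x ≤ |x - m| := round_le x m

theorem nearestDist_pos {α : ℝ} (hα : Irrational α) {k : ℕ} (hk : 1 ≤ k) :
    0 < nearestDist (k * α) := by
  rw [nearestDist, abs_pos, sub_ne_zero]
  exact (hα.natCast_mul (by omega)).ne_int _

/-- `α` is badly approximable. -/
def BadlyApproximable (α : ℝ) : Prop :=
  ∃ c : ℝ, 0 < c ∧ ∀ k : ℕ, 1 ≤ k → c ≤ k * nearestDist (k * α)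

/-- Two consecutive indices are carried because the recurrence for continuants has order two. -/
theorem exists_int_contsAux (α : ℝ) (n : ℕ) :
    (∃ a b : ℤ, (GenContFract.of α).contsAux n = ⟨a, b⟩) ∧
      ∃ a b : ℤ, (GenContFract.of α).contsAux (n + 1) = ⟨a, b⟩ := by
  induction n with
  | zero =>
    refine ⟨⟨1, 0, by simp [GenContFract.contsAux]⟩, ⌊α⌋, 1, ?_⟩
    simp [GenContFract.contsAux, GenContFract.of_h_eq_floor]
  | succ n ih =>
    obtain ⟨⟨a, b, h⟩, a', b', h'⟩ := ih
    refine ⟨⟨a', b', h'⟩, ?_⟩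
    cases hs : (GenContFract.of α).s.get? n with
    | none =>
      exact ⟨a', b', by
        rw [GenContFract.contsAux_stable_step_of_terminated hs, h']⟩
    | some gp =>
      obtain ⟨hga, z, hz⟩ := GenContFract.of_partNum_eq_one_and_exists_int_partDen_eq hs
      refine ⟨z * a' + a, z * b' + b, ?_⟩
      rw [GenContFract.contsAux_recurrence hs h h']
      simp [hga, hz]

theorem exists_int_nums_dens (α : ℝ) (n : ℕ) :
    ∃ a b : ℤ, (GenContFract.of α).nums n = a ∧ (GenContFract.of α).dens n = b := by
  obtain ⟨a, b, h⟩ := (exists_int_contsAux α n).2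
  exact ⟨a, b, by rw [GenContFract.num_eq_conts_a, GenContFract.nth_cont_eq_succ_nth_contAux, h],
    by rw [GenContFract.den_eq_conts_b, GenContFract.nth_cont_eq_succ_nth_contAux, h]⟩

theorem not_terminatedAt {α : ℝ} (hα : Irrational α) (n : ℕ) :
    ¬(GenContFract.of α).TerminatedAt n := fun h => by
  obtain ⟨q, hq⟩ := GenContFract.exists_rat_eq_of_terminates (v := α) ⟨n, h⟩
  exact hα ⟨q, hq.symm⟩

theorem one_le_dens {α : ℝ} (hα : Irrational α) (n : ℕ) : 1 ≤ (GenContFract.of α).dens n := by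
  have h := GenContFract.succ_nth_fib_le_of_nth_den (v := α) (n := n)
    (Or.inr (not_terminatedAt hα _))
  have h' : (1 : ℝ) ≤ Nat.fib (n + 1) := by
    exact_mod_cast Nat.fib_pos.2 (Nat.succ_pos n)
  linarith

/-- The convergent A/B that precedes a coefficient b has error at most 1/(bB²), so testing bad
approximability at k = B gives c ≤ 1/b. -/
theorem BadlyApproximable.boundedCoefficients {α : ℝ} (hα : Irrational α)
    (h : BadlyApproximable α) : BoundedCoefficients α := by
  obtain ⟨c, hc, h⟩ := h
  refine ⟨1 / c, fun n b hb => ?_⟩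
  obtain ⟨A, B, hA, hB⟩ := exists_int_nums_dens α n
  have hB1 := one_le_dens hα n
  have hconv : (GenContFract.of α).convs n = A / B := by
    rw [GenContFract.conv_eq_num_div_den, hA, hB]
  have hle := GenContFract.abs_sub_convergents_le' hb
  have hb1 : (1 : ℝ) ≤ b := GenContFract.of_one_le_get?_partDen hb
  rw [hconv, hB] at hle
  rw [hB] at hB1
  have hB1' : 1 ≤ B := by exact_mod_cast hB1
  lift B to ℕ using by omega
  have := h B (by omega)
  have h2 : nearestDist ((B : ℕ) * α) ≤ |B * α - A| := nearestDist_le _ _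
  push_cast at hle hB1
  have hpos : (0 : ℝ) < B := by linarith
  have h3 : |(B : ℝ) * α - A| = B * |α - A / B| := by
    rw [← abs_of_pos hpos, ← abs_mul, abs_of_pos hpos]
    congr 1
    field_simp
  have h4 : c ≤ B * (B * |α - A / B|) :=
    this.trans (by rw [← h3]; gcongr)
  have h5 : (B : ℝ) * (B * |α - A / B|) ≤ B * (B * (1 / (b * B * B))) := by gcongr
  have h6 : (B : ℝ) * (B * (1 / (b * B * B))) = 1 / b := by
    field_simp
  rw [le_div_iff₀ hc]
  have h7 : c ≤ 1 / b := by linarith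
  rw [le_div_iff₀ (by linarith)] at h7
  linarith

theorem BoundedCoefficients.badlyApproximable {α : ℝ} (hα : Irrational α)
    (h : BoundedCoefficients α) : BadlyApproximable α := by
  obtain ⟨C, hC⟩ := h
  have hC0 : 1 ≤ C := by
    obtain ⟨gp, hgp⟩ := Option.ne_none_iff_exists'.1 (not_terminatedAt hα 0)
    have := GenContFract.partDen_eq_s_b hgp
    exact (GenContFract.of_one_le_get?_partDen this).trans (hC _ _ this)
  refine ⟨min (1 / 2) (1 / (C + 2)), by positivity, fun k hk => ?_⟩
  by_contra! hlt
  obtain ⟨hlt1, hlt2⟩ := lt_min_iff.1 hlt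
  set p := round ((k : ℝ) * α) with hp
  have hkpos : (0 : ℝ) < k := by exact_mod_cast hk
  set r : ℚ := p / k with hr
  have hrc : (r : ℝ) = p / k := by rw [hr]; push_cast; rfl
  have hd : nearestDist (k * α) = k * |α - r| := by
    rw [nearestDist, ← hp, hrc, ← abs_of_pos hkpos, ← abs_mul, abs_of_pos hkpos]
    congr 1
    field_simp
  have hden : (r.den : ℝ) ≤ k := by
    have : r.den ∣ k := by
      have := Rat.den_dvd p k
      have e : r = Rat.divInt p k := by rw [Rat.divInt_eq_div, hr]; push_cast; rfl
      rw [e]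
      exact Int.natCast_dvd_natCast.1 this
    exact_mod_cast Nat.le_of_dvd hk this
  have hdpos : (0 : ℝ) < r.den := by exact_mod_cast r.den_pos
  rw [hd] at hlt1 hlt2
  -- Legendre's criterion: an approximation this good must be a convergent. This is the use of the
  -- bound 1/2 in the minimum.
  have hleg : |α - r| < 1 / (2 * (r.den : ℝ) ^ 2) := by
    rw [lt_div_iff₀ (by positivity)]
    calc |α - r| * (2 * (r.den : ℝ) ^ 2) ≤ |α - r| * (2 * (k : ℝ) ^ 2) := by gcongr
      _ < 1 := by nlinarith
  obtain ⟨n, hn⟩ := Real.exists_convs_eq_rat hleg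
  obtain ⟨A, B, hA, hB⟩ := exists_int_nums_dens α n
  obtain ⟨A', B', hA', hB'⟩ := exists_int_nums_dens α (n + 1)
  have hB1 := one_le_dens hα n
  -- The determinant identity makes A and B coprime; as A/B = p/k, B divides k.
  have hBk : (B : ℝ) ≤ k := by
    have hdet := SimpContFract.determinant (s := SimpContFract.of α) (n := n)
      (not_terminatedAt hα n)
    have hdet' : (A : ℝ) * B' - B * A' = (-1) ^ (n + 1) := by
      rw [← hA, ← hB, ← hA', ← hB']; exact hdet
    have hdetZ : A * B' - B * A' = (-1) ^ (n + 1) := by exact_mod_cast hdet'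
    have hAk : (A : ℝ) * k = p * B := by
      rw [GenContFract.conv_eq_num_div_den, hA, hB, hrc] at hn
      rw [hB] at hB1
      rw [div_eq_div_iff (by linarith) hkpos.ne'] at hn
      exact hn
    have hAkZ : A * k = p * B := by exact_mod_cast hAk
    have hdvd : B ∣ k := by
      have h1 : B * (p * B' - A' * k) = (-1) ^ (n + 1) * k := by
        rw [← hdetZ]; linear_combination (-B') * hAkZ
      have h2 : B ∣ (-1) ^ (n + 1) * k := ⟨_, h1.symm⟩
      rcases neg_one_pow_eq_or ℤ (n + 1) with h | h <;> rw [h] at h2 <;> simpa using h2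
    exact_mod_cast Int.le_of_dvd (by omega) hdvd
  obtain ⟨ifp', hs', -⟩ : ∃ i, GenContFract.IntFractPair.stream α (n + 1) = some i ∧ True := by
    have := not_terminatedAt hα n
    rw [GenContFract.of_terminatedAt_n_iff_succ_nth_intFractPair_stream_eq_none] at this
    obtain ⟨i, hi⟩ := Option.ne_none_iff_exists'.1 this
    exact ⟨i, hi, trivial⟩
  obtain ⟨ifp, hs, hfr, hof⟩ := GenContFract.IntFractPair.succ_nth_stream_eq_some_iff.1 hs'
  have hsub := GenContFract.sub_convs_eq hs
  have hb := GenContFract.get?_of_eq_some_of_succ_get?_intFractPair_stream hs'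
  have hbC : (ifp'.b : ℝ) ≤ C := hC n _ (GenContFract.partDen_eq_s_b hb)
  have hfrC : ifp.fr⁻¹ ≤ C + 1 := by
    have : ifp'.b = ⌊ifp.fr⁻¹⌋ := by rw [← hof]; rfl
    have h3 := Int.lt_floor_add_one ifp.fr⁻¹
    rw [← this] at h3
    linarith
  have hfrpos : 0 < ifp.fr := lt_of_le_of_ne (GenContFract.IntFractPair.nth_stream_fr_nonneg hs)
    (Ne.symm hfr)
  simp only [if_neg hfr] at hsub
  rw [hn] at hsub
  have e1 : ((GenContFract.of α).contsAux (n + 1)).b = B := by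
    rw [← hB, GenContFract.den_eq_conts_b, GenContFract.nth_cont_eq_succ_nth_contAux]
  have hpB0 : 0 ≤ ((GenContFract.of α).contsAux n).b := GenContFract.zero_le_of_contsAux_b
  have hpB : ((GenContFract.of α).contsAux n).b ≤ B := by
    cases n with
    | zero =>
      rw [hB] at hB1
      simpa [GenContFract.contsAux] using (by linarith : (0 : ℝ) ≤ B)
    | succ m =>
      rw [← hB]
      have := GenContFract.of_den_mono (v := α) (n := m)
      rwa [GenContFract.den_eq_conts_b, GenContFract.nth_cont_eq_succ_nth_contAux] at this
  rw [e1] at hsub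
  rw [hB] at hB1
  -- Exact error of a convergent. The complete quotient `ifp.fr⁻¹` is at most C + 1 and both
  -- denominators are at most k, whence the constant C + 2.
  have habs : |α - r| = 1 / (B * (ifp.fr⁻¹ * B + ((GenContFract.of α).contsAux n).b)) := by
    rw [hsub, abs_div, abs_pow, abs_neg, abs_one, one_pow, abs_of_pos]
    positivity
  have hBpos : (0 : ℝ) < B := by linarith
  have hlow : 1 / (k * ((C + 1) * k + k)) ≤ |α - r| := by
    rw [habs]
    have : ((GenContFract.of α).contsAux n).b ≤ k := hpB.trans hBk
    gcongr
  have : (1 : ℝ) / (C + 2) ≤ k * (k * |α - r|) := by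
    calc (1 : ℝ) / (C + 2) = k * (k * (1 / (k * ((C + 1) * k + k)))) := by field_simp; ring
      _ ≤ _ := by gcongr
  linarith

theorem boundedCoefficients_iff {α : ℝ} (hα : Irrational α) :
    BoundedCoefficients α ↔ BadlyApproximable α :=
  ⟨fun h => h.badlyApproximable hα, fun h => h.boundedCoefficients hα⟩

/-! ### Best approximation denominators. -/

section

/-- `q < q'` are consecutive best approximation denominators of `α`. -/
structure IsConsecutive (α : ℝ) (q q' : ℕ) : Prop where
  one_le : 1 ≤ q
  lt : q < q'
  dist_lt : nearestDist (q' * α) < nearestDist (q * α)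
  le_dist : ∀ k : ℕ, 1 ≤ k → k < q' → nearestDist (q * α) ≤ nearestDist (k * α)

theorem exists_nearestDist_le (α : ℝ) {n : ℕ} (hn : 1 ≤ n) :
    ∃ k : ℕ, 1 ≤ k ∧ k ≤ n ∧ nearestDist (k * α) ≤ 1 / (n + 1) := by
  obtain ⟨k, h1, h2, h3⟩ := Real.exists_nat_abs_mul_sub_round_le α hn
  exact ⟨k, h1, h2, h3⟩

theorem exists_nearestDist_lt {α ε : ℝ} (hε : 0 < ε) :
    ∃ k : ℕ, 1 ≤ k ∧ (k : ℝ) ≤ 1 / ε + 1 ∧ nearestDist (k * α) < ε := by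
  obtain ⟨k, h1, h2, h3⟩ := exists_nearestDist_le α (n := ⌊1 / ε⌋₊ + 1) (by omega)
  have hfl : (⌊1 / ε⌋₊ : ℝ) ≤ 1 / ε := Nat.floor_le (by positivity)
  have hfl' := Nat.lt_floor_add_one (1 / ε)
  refine ⟨k, h1, ?_, h3.trans_lt ?_⟩
  · have : (k : ℝ) ≤ ⌊1 / ε⌋₊ + 1 := by exact_mod_cast h2
    linarith
  · rw [div_lt_iff₀ (by positivity)]
    rw [div_lt_iff₀ hε] at hfl'
    push_cast
    nlinarith

variable {α : ℝ}

theorem exists_minimal_nearestDist_lt {ε : ℝ} (hε : 0 < ε) :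
    ∃ m : ℕ, 1 ≤ m ∧ nearestDist (m * α) < ε ∧
      ∀ k : ℕ, 1 ≤ k → k < m → ε ≤ nearestDist (k * α) := by
  classical
  have hex : ∃ k : ℕ, 1 ≤ k ∧ nearestDist (k * α) < ε := by
    obtain ⟨k, h1, -, h3⟩ := exists_nearestDist_lt (α := α) hε
    exact ⟨k, h1, h3⟩
  refine ⟨Nat.find hex, (Nat.find_spec hex).1, (Nat.find_spec hex).2, fun k hk hlt => ?_⟩
  by_contra! h
  exact Nat.find_min hex hlt ⟨hk, h⟩

/-- A best approximation denominator has a successor. -/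
theorem exists_isConsecutive_of_best (hα : Irrational α) {q : ℕ} (hq : 1 ≤ q)
    (hbest : ∀ k : ℕ, 1 ≤ k → k ≤ q → nearestDist (q * α) ≤ nearestDist (k * α)) :
    ∃ q', IsConsecutive α q q' := by
  obtain ⟨m, hm1, hm, hmin⟩ := exists_minimal_nearestDist_lt (α := α) (nearestDist_pos hα hq)
  refine ⟨m, hq, ?_, hm, hmin⟩
  by_contra! hle
  exact absurd hm (not_lt.2 (hbest m hm1 hle))

/-- Take q minimizing ‖kα‖ over 1 ≤ k ≤ n; its successor must exceed n. -/
theorem exists_isConsecutive (hα : Irrational α) {n : ℕ} (hn : 1 ≤ n) :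
    ∃ q q', IsConsecutive α q q' ∧ q ≤ n ∧ n < q' ∧
      ∀ k : ℕ, 1 ≤ k → k ≤ n → nearestDist (q * α) ≤ nearestDist (k * α) := by
  obtain ⟨q, hq, hmin⟩ := Finset.exists_min_image (Finset.Icc 1 n)
    (fun k : ℕ => nearestDist (k * α)) ⟨1, by simp [hn]⟩
  rw [Finset.mem_Icc] at hq
  have hmin' : ∀ k : ℕ, 1 ≤ k → k ≤ n → nearestDist (q * α) ≤ nearestDist (k * α) :=
    fun k h1 h2 => hmin k (Finset.mem_Icc.2 ⟨h1, h2⟩)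
  obtain ⟨q', h⟩ := exists_isConsecutive_of_best hα hq.1
    fun k h1 h2 => hmin' k h1 (h2.trans hq.2)
  refine ⟨q, q', h, hq.2, ?_, hmin'⟩
  by_contra! hle
  have h1 := h.one_le
  have h2 := h.lt
  exact absurd h.dist_lt (not_lt.2 (hmin' q' (by omega) hle))

namespace IsConsecutive

variable {q q' : ℕ}

theorem next (h : IsConsecutive α q q') (hα : Irrational α) : ∃ q'', IsConsecutive α q' q'' := by
  have h1 := h.one_le
  have h2 := h.lt
  refine exists_isConsecutive_of_best hα (by omega) fun k hk hkq => ?_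
  rcases hkq.lt_or_eq with hlt | rfl
  · exact h.dist_lt.le.trans (h.le_dist k hk hlt)
  · exact le_rfl

theorem mul_dist_le_one (h : IsConsecutive α q q') : q' * nearestDist (q * α) ≤ 1 := by
  have h1 := h.one_le
  have h2 := h.lt
  obtain ⟨k, hk1, hk2, hk3⟩ := exists_nearestDist_le α (n := q' - 1) (by omega)
  have hle := (h.le_dist k hk1 (by omega)).trans hk3
  have hc : ((q' - 1 : ℕ) : ℝ) + 1 = q' := by
    rw [Nat.cast_sub (by omega)]; push_cast; ring
  rw [hc, le_div_iff₀ (by exact_mod_cast (by omega : 0 < q'))] at hle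
  linarith

theorem one_le_two_mul_dist (h : IsConsecutive α q q') :
    1 ≤ 2 * (q' * nearestDist (q * α)) := by
  have h1 := h.one_le
  have h2 := h.lt
  have h3 := h.dist_lt
  have hqq : (q : ℝ) < q' := by exact_mod_cast h2
  have hq : (1 : ℝ) ≤ q := by exact_mod_cast h1
  unfold nearestDist at h3 ⊢
  set p := round ((q : ℝ) * α)
  set p' := round ((q' : ℝ) * α)
  -- A nonzero integer determinant gives 1 ≤ q'‖qα‖ + q‖q'α‖, and each term is at most q'‖qα‖.
  have hne : (q : ℤ) * p' - q' * p ≠ 0 := by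
    intro h0
    have h0' : (q : ℝ) * p' = q' * p := by
      have : (q : ℤ) * p' = q' * p := by omega
      exact_mod_cast this
    have e : q' * |q * α - p| = q * |q' * α - p'| := by
      rw [← abs_of_nonneg (Nat.cast_nonneg (α := ℝ) q'), ← abs_mul,
        ← abs_of_nonneg (Nat.cast_nonneg (α := ℝ) q), ← abs_mul]
      simp only [abs_of_nonneg (Nat.cast_nonneg (α := ℝ) _)]
      congr 1
      linear_combination h0'
    have := abs_nonneg ((q' : ℝ) * α - p')
    nlinarith
  have hone : (1 : ℝ) ≤ |(q : ℝ) * p' - q' * p| := by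
    exact_mod_cast Int.one_le_abs hne
  have e : (q : ℝ) * p' - q' * p = q' * (q * α - p) - q * (q' * α - p') := by ring
  rw [e] at hone
  have htri := abs_sub (q' * (q * α - p)) (q * (q' * α - p'))
  rw [abs_mul, abs_mul, Nat.abs_cast, Nat.abs_cast] at htri
  have := abs_nonneg ((q' : ℝ) * α - p')
  nlinarith

/-- Consecutive best approximations lie on opposite sides. -/
theorem mul_neg (h : IsConsecutive α q q') (hα : Irrational α) :
    (q * α - round (q * α)) * (q' * α - round (q' * α)) < 0 := by
  have h1 := h.one_le
  have h2 := h.lt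
  have h3 := h.dist_lt
  have h4 := nearestDist_pos hα (k := q') (by omega)
  by_contra! h0
  -- With equal signs the errors would partly cancel, so q' - q < q' would beat q.
  have h5 := h.le_dist (q' - q) (by omega) (by omega)
  have h6 := nearestDist_le ((q' - q : ℕ) * α) (round ((q' : ℝ) * α) - round ((q : ℝ) * α))
  rw [Nat.cast_sub h2.le] at h5 h6
  push_cast at h6
  have e : ((q' : ℝ) - q) * α - (round ((q' : ℝ) * α) - round ((q : ℝ) * α))
    = (q' * α - round ((q' : ℝ) * α)) - (q * α - round ((q : ℝ) * α)) := by ring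
  rw [e] at h6
  unfold nearestDist at h3 h4 h5 h6
  set x := q * α - round ((q : ℝ) * α)
  set y := q' * α - round ((q' : ℝ) * α)
  have h7 : |x| ≤ |y - x| := h5.trans h6
  rcases abs_cases x with ⟨hx, hx'⟩ | ⟨hx, hx'⟩ <;> rcases abs_cases y with ⟨hy, hy'⟩ | ⟨hy, hy'⟩ <;>
    rcases abs_cases (y - x) with ⟨hz, hz'⟩ | ⟨hz, hz'⟩ <;> nlinarith

theorem add_le (h : IsConsecutive α q q') (hα : Irrational α) {q'' : ℕ}
    (h' : IsConsecutive α q' q'') : q + q' ≤ q'' := by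
  have h1 := h.one_le
  have h2 := h.lt
  have h3 := h.dist_lt
  have h3' := h'.dist_lt
  have h2' := h'.lt
  have h4 := nearestDist_pos hα (k := q'') (by omega)
  by_contra! h0
  have h5 := h.le_dist (q'' - q) (by omega) (by omega)
  have h6 := nearestDist_le ((q'' - q : ℕ) * α) (round ((q'' : ℝ) * α) - round ((q : ℝ) * α))
  rw [Nat.cast_sub (by omega)] at h5 h6
  push_cast at h6
  have e : ((q'' : ℝ) - q) * α - (round ((q'' : ℝ) * α) - round ((q : ℝ) * α))
    = (q'' * α - round ((q'' : ℝ) * α)) - (q * α - round ((q : ℝ) * α)) := by ring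
  rw [e] at h6
  have h8 := h.mul_neg hα
  have h8' := h'.mul_neg hα
  unfold nearestDist at h3 h3' h4 h5 h6
  set x := q * α - round ((q : ℝ) * α)
  set y := q'' * α - round ((q'' : ℝ) * α)
  set z := q' * α - round ((q' : ℝ) * α)
  have h7 : |x| ≤ |y - x| := h5.trans h6
  rcases lt_or_ge z 0 with hz | hz
  · have hx : 0 < x := by nlinarith
    have hy : 0 < y := by nlinarith
    rw [abs_of_pos hx, abs_of_nonpos] at h7
    · rw [abs_of_pos hy] at h4; linarith
    · rw [abs_of_pos hx] at h3; rw [abs_of_pos hy] at h3'; linarith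
  · have hx : x < 0 := by nlinarith
    have hy : y < 0 := by nlinarith
    rw [abs_of_neg hx, abs_of_nonneg] at h7
    · rw [abs_of_neg hy] at h4; linarith
    · rw [abs_of_neg hx] at h3; rw [abs_of_neg hy] at h3'; linarith

end IsConsecutive

/-- If q' < 6q/5, then q'' ≥ q + q' > 11q'/6, so the next pair has the required gap. -/
theorem exists_isConsecutive_ratio (hα : Irrational α) (n : ℕ) :
    ∃ q q', IsConsecutive α q q' ∧ n ≤ q ∧ 6 * q ≤ 5 * q' := by
  obtain ⟨q₀, q, h₀, -, hn, -⟩ := exists_isConsecutive hα (n := n + 1) (by omega)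
  obtain ⟨q', h⟩ := h₀.next hα
  obtain ⟨q'', h'⟩ := h.next hα
  have := h.lt
  by_cases hr : 6 * q ≤ 5 * q'
  · exact ⟨q, q', h, by omega, hr⟩
  · have := h.add_le hα h'
    exact ⟨q', q'', h', by omega, by omega⟩

theorem exists_mul_nearestDist_lt (h : ¬BadlyApproximable α) {ε : ℝ} (hε : 0 < ε) :
    ∃ k : ℕ, 1 ≤ k ∧ k * nearestDist (k * α) < ε := by
  by_contra! hc
  exact h ⟨ε, hε, hc⟩

end

/-! ### Words, atoms and recurrence times. -/

section

section Words

variable {X : Type*}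

/-- The word of length `n` read by `f` along the orbit of `x`. -/
def itinerary (T : X → X) (f : X → Fin 2) (n : ℕ) (x : X) : Fin n → Fin 2 :=
  fun i => f (T^[i] x)

/-- The smallest `k ≥ 1` such that the word `w` occurs at distance `k` from another occurrence. -/
noncomputable def wordRecurrence (T : X → X) (f : X → Fin 2) (n : ℕ) (w : Fin n → Fin 2) : ℕ∞ :=
  ⨅ k ∈ {k : ℕ | 1 ≤ k ∧ ∃ y, itinerary T f n y = w ∧ itinerary T f n (T^[k] y) = w}, (k : ℕ∞)

theorem itinerary_eq_iff {T : X → X} {f : X → Fin 2} {n : ℕ} {x y : X} :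
    itinerary T f n x = itinerary T f n y ↔ ∀ i < n, f (T^[i] x) = f (T^[i] y) :=
  ⟨fun h i hi => congrFun h ⟨i, hi⟩, fun h => funext fun i => h i i.2⟩

theorem atomOf_iteratedPartition (T : X → X) (f : X → Fin 2) (n : ℕ) (x : X) :
    atomOf (iteratedPartition T {{x | f x = 0}, {x | f x = 1}} n) x
      = {y | itinerary T f n y = itinerary T f n x} := by
  have key : ∀ A ∈ ({{x | f x = 0}, {x | f x = 1}} : Set (Set X)), ∀ z ∈ A, A = {y | f y = f z} := by
    rintro A (rfl | rfl) z hz <;> ext y <;> simp only [mem_ofPred_eq] at hz ⊢ <;> rw [hz]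
  ext y
  simp only [atomOf, iteratedPartition, mem_sUnion, mem_ofPred_eq, itinerary_eq_iff]
  constructor
  · rintro ⟨B, ⟨⟨-, A, hA, rfl⟩, hx⟩, hy⟩ i hi
    rw [mem_iInter] at hx hy
    have := hy ⟨i, hi⟩
    rw [key _ (hA ⟨i, hi⟩) _ (hx ⟨i, hi⟩)] at this
    exact this
  · intro h
    have hx : x ∈ ⋂ i : Fin n, T^[i] ⁻¹' {z | f z = f (T^[i] x)} := by simp
    refine ⟨_, ⟨⟨⟨x, hx⟩, fun i => {z | f z = f (T^[i] x)}, fun i => ?_, rfl⟩, hx⟩, ?_⟩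
    · have : ∀ a : Fin 2, {z | f z = a} ∈ ({{x | f x = 0}, {x | f x = 1}} : Set (Set X)) := by
        intro a; fin_cases a <;> simp
      exact this _
    · simp only [mem_iInter, mem_preimage, mem_ofPred_eq]
      exact fun i => h i i.2

theorem setRecurrence_atomOf (T : X → X) (f : X → Fin 2) (n : ℕ) (x : X) :
    setRecurrence T (atomOf (iteratedPartition T {{x | f x = 0}, {x | f x = 1}} n) x)
      = wordRecurrence T f n (itinerary T f n x) := by
  rw [atomOf_iteratedPartition]
  apply le_antisymm
  · refine le_iInf₂ fun k hk => ?_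
    obtain ⟨hk1, y, hy, hky⟩ := hk
    exact (iInf₂_le y hy).trans (iInf₂_le k ⟨hk1, hky⟩)
  · refine le_iInf₂ fun y hy => le_iInf₂ fun k hk => ?_
    exact iInf₂_le k ⟨hk.1, y, hy, hk.2⟩

theorem wordRecurrence_le {T : X → X} {f : X → Fin 2} {n : ℕ} {w : Fin n → Fin 2} {k : ℕ}
    (hk : 1 ≤ k) {y : X} (h : itinerary T f n y = w) (h' : itinerary T f n (T^[k] y) = w) :
    wordRecurrence T f n w ≤ k :=
  iInf₂_le k ⟨hk, y, h, h'⟩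

/-- Dropping the first letter preserves recurrences. This inequality is what makes the rates
monotone along orbits. -/
theorem wordRecurrence_image_le (T : X → X) (f : X → Fin 2) (n : ℕ) (x : X) :
    wordRecurrence T f n (itinerary T f n (T x))
      ≤ wordRecurrence T f (n + 1) (itinerary T f (n + 1) x) := by
  refine le_iInf₂ fun k hk => ?_
  obtain ⟨hk1, y, h, h'⟩ := hk
  rw [itinerary_eq_iff] at h h'
  refine wordRecurrence_le hk1 (y := T y) ?_ ?_ <;> rw [itinerary_eq_iff] <;> intro i hi
  · simpa only [← Function.iterate_succ_apply] using h (i + 1) (by omega)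
  · rw [← Function.iterate_succ_apply T k y, Function.iterate_succ_apply' T k y]
    simpa only [← Function.iterate_succ_apply] using h' (i + 1) (by omega)

end Words

/-! ### Atoms of the rotation as intervals. -/

variable {α : ℝ}

theorem letter_eq_iff {s t : UnitIco} :
    letter α s = letter α t ↔ ((s : ℝ) < 1 - α ↔ (t : ℝ) < 1 - α) := by
  unfold letter
  split_ifs with h1 h2 h2 <;> simp [h1, h2]

theorem rotationPartition_eq :
    rotationPartition α = {{t | letter α t = 0}, {t | letter α t = 1}} := by
  unfold rotationPartition letter
  congr 1
  · ext t
    by_cases h : (t : ℝ) < 1 - α <;> simp only [mem_ofPred_eq, h, if_true, if_false, mem_Ico]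
    · simp [t.2.1]
    · simp
  · congr 1
    ext t
    by_cases h : (t : ℝ) < 1 - α <;> simp only [mem_ofPred_eq, h, if_true, if_false, mem_Ico]
    · exact iff_of_false (fun h' => absurd h (not_lt.2 h'.1)) (by decide)
    · simp [t.2.2, not_lt.1 h]

theorem rotation_iterate_coe (k : ℕ) (t : UnitIco) :
    (((rotation α)^[k] t : UnitIco) : ℝ) = Int.fract ((t : ℝ) + k * α) := by
  induction k with
  | zero =>
    have : Int.fract (t : ℝ) = t := Int.fract_eq_self.2 t.2
    simp [this]
  | succ k ih =>
    rw [Function.iterate_succ_apply']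
    change Int.fract (((rotation α)^[k] t : ℝ) + α) = _
    rw [ih, Int.fract_eq_fract]
    refine ⟨-⌊(t : ℝ) + k * α⌋, ?_⟩
    rw [Int.fract]
    push_cast
    ring

theorem exists_int_rotation_iterate (k : ℕ) (t : UnitIco) :
    ∃ m : ℤ, (((rotation α)^[k] t : UnitIco) : ℝ) = t + k * α - m :=
  ⟨⌊(t : ℝ) + k * α⌋, by rw [rotation_iterate_coe]; rfl⟩

theorem rotation_iterate_eq {k : ℕ} {t : UnitIco} {x : ℝ} (m : ℤ) (h0 : 0 ≤ x) (h1 : x < 1)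
    (h : (t : ℝ) + (k : ℝ) * α - m = x) : (((rotation α)^[k] t : UnitIco) : ℝ) = x := by
  rw [rotation_iterate_coe, Int.fract_eq_iff]
  exact ⟨h0, h1, m, by linarith⟩

theorem nearestDist_le_rotation_iterate (k : ℕ) (t : UnitIco) :
    nearestDist (k * α) ≤ |(((rotation α)^[k] t : UnitIco) : ℝ) - t| := by
  obtain ⟨m, hm⟩ := exists_int_rotation_iterate (α := α) k t
  convert nearestDist_le (k * α) m using 2
  rw [hm]; ring

theorem rotation_coe_of_lt (h0 : 0 < α) {t : UnitIco} (ht : (t : ℝ) < 1 - α) :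
    (rotation α t : ℝ) = t + α := by
  have := t.2.1
  exact rotation_iterate_eq (k := 1) (t := t) 0 (by linarith) (by linarith) (by simp)

theorem rotation_coe_of_le (h1 : α < 1) {t : UnitIco} (ht : 1 - α ≤ (t : ℝ)) :
    (rotation α t : ℝ) = t + α - 1 := by
  have := t.2.2
  exact rotation_iterate_eq (k := 1) (t := t) 1 (by linarith) (by linarith) (by simp)

/-- The letter records whether the rotation adds α or α - 1, so equal letters preserve the
difference as a real number, not only mod 1. -/
theorem rotation_sub (h0 : 0 < α) (h1 : α < 1) {s t : UnitIco} (h : letter α s = letter α t) :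
    (rotation α t : ℝ) - rotation α s = t - s := by
  rw [letter_eq_iff] at h
  by_cases hs : (s : ℝ) < 1 - α
  · rw [rotation_coe_of_lt h0 hs, rotation_coe_of_lt h0 (h.1 hs)]; ring
  · rw [rotation_coe_of_le h1 (not_lt.1 hs),
      rotation_coe_of_le h1 (not_lt.1 fun h' => hs (h.2 h'))]; ring

theorem rotation_iterate_sub (h0 : 0 < α) (h1 : α < 1) {n : ℕ} {s t : UnitIco}
    (h : ∀ i < n, letter α ((rotation α)^[i] s) = letter α ((rotation α)^[i] t)) {i : ℕ}
    (hi : i ≤ n) :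
    (((rotation α)^[i] t : UnitIco) : ℝ) - ((rotation α)^[i] s : UnitIco) = t - s := by
  induction i with
  | zero => rfl
  | succ i ih =>
    rw [Function.iterate_succ_apply', Function.iterate_succ_apply',
      rotation_sub h0 h1 (h i (by omega)), ih (by omega)]

/-- Two points have the same itinerary if no discontinuity separates them. -/
theorem itinerary_eq_of_forall_notMem (h0 : 0 < α) (h1 : α < 1) {n : ℕ} {s t : UnitIco}
    (hst : s ≤ t)
    (h : ∀ i : ℕ, 1 ≤ i → i ≤ n → ∀ m : ℤ, (s : ℝ) < m - i * α → ¬(m - i * α ≤ (t : ℝ))) :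
    itinerary (rotation α) (letter α) n s = itinerary (rotation α) (letter α) n t := by
  rw [itinerary_eq_iff]
  intro i
  induction i using Nat.strong_induction_on with
  | _ i ih =>
  intro hi
  have hd := rotation_iterate_sub h0 h1 (n := i) (s := s) (t := t)
    (fun j hj => ih j hj (by omega)) le_rfl
  have hst' : (s : ℝ) ≤ t := hst
  obtain ⟨m, hm⟩ := exists_int_rotation_iterate (α := α) i s
  rw [letter_eq_iff]
  refine ⟨fun hs => ?_, fun ht => by linarith⟩
  by_contra! ht
  -- The letter at time i changes at 1 - α, which pulls back to 1 + m - (i + 1)α; hence indices run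
  -- over 1, …, n.
  have := h (i + 1) (by omega) hi (1 + m)
  push_cast at this
  exact this (by linarith) (by linarith)

theorem itinerary_eq_of_mem_Icc (h0 : 0 < α) (h1 : α < 1) {n : ℕ} {s t u : UnitIco}
    (hst : itinerary (rotation α) (letter α) n s = itinerary (rotation α) (letter α) n t)
    (hsu : s ≤ u) (hut : u ≤ t) :
    itinerary (rotation α) (letter α) n s = itinerary (rotation α) (letter α) n u := by
  refine itinerary_eq_of_forall_notMem h0 h1 hsu fun i hi1 hin m hm hm' => ?_
  have hd := rotation_iterate_sub h0 h1 (itinerary_eq_iff.1 hst) hin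
  obtain ⟨k, hk⟩ := exists_int_rotation_iterate (α := α) i s
  have hut' : (u : ℝ) ≤ t := hut
  have hs0 := ((rotation α)^[i] s).2.1
  have ht1 := ((rotation α)^[i] t).2.2
  -- A cut between s and u would put an integer strictly between 0 and 1, since the i-th images of s
  -- and t differ by exactly t - s.
  have e1 : (0 : ℝ) < (m - k : ℤ) := by push_cast; linarith
  have e2 : ((m - k : ℤ) : ℝ) < 1 := by push_cast; linarith
  have e1' : 0 < m - k := by exact_mod_cast e1
  have e2' : m - k < 1 := by exact_mod_cast e2
  omega

/-! ### Hitting times of the backward orbit of 0. -/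

section Visits

theorem exists_int_mem_Ioc (hα : Irrational α) {a b : ℝ} (hab : a < b) :
    ∃ i m : ℤ, m - i * α ∈ Ioc a b := by
  have hd : Dense (AddSubgroup.closure ({α, 1} : Set ℝ) : Set ℝ) := by
    rw [dense_addSubgroupClosure_pair_iff, div_one]; exact hα
  obtain ⟨x, hx, hx1, hx2⟩ := hd.exists_between hab
  obtain ⟨i, m, rfl⟩ := AddSubgroup.mem_closure_pair.1 hx
  refine ⟨-i, m, ?_⟩
  simp only [zsmul_eq_mul, mul_one] at hx1 hx2
  push_cast
  constructor <;> linarith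

/-- The backward orbit of `0` visits every interval of length `‖qα‖ + ‖q'α‖` before time `q'`. -/
theorem IsConsecutive.exists_mem_Ioc {q q' : ℕ} (h : IsConsecutive α q q') (hα : Irrational α)
    {a b : ℝ} (hab : nearestDist (q * α) + nearestDist (q' * α) ≤ b - a) :
    ∃ i : ℕ, 1 ≤ i ∧ i ≤ q' ∧ ∃ m : ℤ, m - i * α ∈ Ioc a b := by
  have h1 := h.one_le
  have h2 := h.lt
  have hpos := nearestDist_pos hα h1
  have hpos' := nearestDist_pos hα (k := q') (by omega)
  have hneg := h.mul_neg hα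
  -- Adding q or q' to the index moves the point in opposite directions by ‖qα‖ or ‖q'α‖. If both
  -- moves left the interval, it would be shorter than their sum.
  have step : ∀ i m : ℤ, m - i * α ∈ Ioc a b →
      (∃ m' : ℤ, m' - (i + q : ℤ) * α ∈ Ioc a b) ∨ ∃ m' : ℤ, m' - (i + q' : ℤ) * α ∈ Ioc a b := by
    rintro i m ⟨hm1, hm2⟩
    unfold nearestDist at hab
    by_contra! hc
    have c1 := hc.1 (m + round (q * α))
    have c2 := hc.2 (m + round (q' * α))
    simp only [mem_Ioc, not_and_or, not_lt, not_le] at c1 c2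
    push_cast at c1 c2
    rcases mul_neg_iff.1 hneg with ⟨hx, hy⟩ | ⟨hx, hy⟩
    · rw [abs_of_pos hx, abs_of_neg hy] at hab
      rcases c1 with c1 | c1 <;> rcases c2 with c2 | c2 <;> linarith
    · rw [abs_of_neg hx, abs_of_pos hy] at hab
      rcases c1 with c1 | c1 <;> rcases c2 with c2 | c2 <;> linarith
  have step' : ∀ i m : ℤ, m - i * α ∈ Ioc a b →
      (∃ m' : ℤ, m' - (i - q : ℤ) * α ∈ Ioc a b) ∨ ∃ m' : ℤ, m' - (i - q' : ℤ) * α ∈ Ioc a b := by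
    rintro i m ⟨hm1, hm2⟩
    unfold nearestDist at hab
    by_contra! hc
    have c1 := hc.1 (m - round (q * α))
    have c2 := hc.2 (m - round (q' * α))
    simp only [mem_Ioc, not_and_or, not_lt, not_le] at c1 c2
    push_cast at c1 c2
    rcases mul_neg_iff.1 hneg with ⟨hx, hy⟩ | ⟨hx, hy⟩
    · rw [abs_of_pos hx, abs_of_neg hy] at hab
      rcases c1 with c1 | c1 <;> rcases c2 with c2 | c2 <;> linarith
    · rw [abs_of_neg hx, abs_of_pos hy] at hab
      rcases c1 with c1 | c1 <;> rcases c2 with c2 | c2 <;> linarith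
  -- Density gives some integer index; these moves, directed toward [1, q'], shrink |i| or land in
  -- the range.
  have main : ∀ N : ℕ, ∀ i m : ℤ, i.natAbs = N → m - i * α ∈ Ioc a b →
      ∃ i : ℕ, 1 ≤ i ∧ i ≤ q' ∧ ∃ m : ℤ, m - i * α ∈ Ioc a b := by
    intro N
    induction N using Nat.strong_induction_on with
    | _ N ih =>
    intro i m hN hm
    by_cases hi : 1 ≤ i ∧ i ≤ q'
    · lift i to ℕ using by omega
      exact ⟨i, by omega, by omega, m, hm⟩
    have fin : ∀ j m' : ℤ, (1 ≤ j ∧ j ≤ q' ∨ j.natAbs < N) → m' - j * α ∈ Ioc a b →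
        ∃ i : ℕ, 1 ≤ i ∧ i ≤ q' ∧ ∃ m : ℤ, m - i * α ∈ Ioc a b := by
      rintro j m' (hj | hj) hm'
      · lift j to ℕ using by omega
        exact ⟨j, by omega, by omega, m', hm'⟩
      · exact ih _ hj j m' rfl hm'
    rcases le_or_gt i 0 with hi0 | hi0
    · rcases step i m hm with ⟨m', hm'⟩ | ⟨m', hm'⟩ <;> exact fin _ m' (by omega) hm'
    · rcases step' i m hm with ⟨m', hm'⟩ | ⟨m', hm'⟩ <;> exact fin _ m' (by omega) hm'
  obtain ⟨i, m, hm⟩ := exists_int_mem_Ioc hα (by linarith : a < b)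
  exact main _ i m rfl hm

theorem IsConsecutive.abs_sub_lt {q q' : ℕ} (h : IsConsecutive α q q') (hα : Irrational α)
    (h0 : 0 < α) (h1 : α < 1) {n : ℕ} (hn : q' ≤ n) {s t : UnitIco}
    (hst : itinerary (rotation α) (letter α) n s = itinerary (rotation α) (letter α) n t) :
    |(t : ℝ) - s| < nearestDist (q * α) + nearestDist (q' * α) := by
  wlog hle : s ≤ t generalizing s t
  · rw [abs_sub_comm]
    exact this hst.symm (le_of_not_ge hle)
  have hle' : (s : ℝ) ≤ t := hle
  rw [abs_of_nonneg (by linarith)]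
  by_contra! hc
  obtain ⟨i, hi1, hi2, m, hm1, hm2⟩ := h.exists_mem_Ioc hα hc
  have hd := rotation_iterate_sub h0 h1 (itinerary_eq_iff.1 hst) (hi2.trans hn)
  obtain ⟨k, hk⟩ := exists_int_rotation_iterate (α := α) i s
  have hs0 := ((rotation α)^[i] s).2.1
  have ht1 := ((rotation α)^[i] t).2.2
  have e1 : (0 : ℝ) < (m - k : ℤ) := by push_cast; linarith
  have e2 : ((m - k : ℤ) : ℝ) < 1 := by push_cast; linarith
  have e1' : 0 < m - k := by exact_mod_cast e1
  have e2' : m - k < 1 := by exact_mod_cast e2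
  omega

end Visits

/-! ### Linear bounds for badly approximable rotations. -/

/-- For badly approximable `α`, recurrence times of words of length `n` are at least linear. -/
theorem lower_bound_of_badlyApproximable (hα : Irrational α) (h0 : 0 < α) (h1 : α < 1) {c : ℝ}
    (hc : 0 < c) (h : ∀ k : ℕ, 1 ≤ k → c ≤ k * nearestDist (k * α)) {n : ℕ} (hn : 1 ≤ c * n)
    {k : ℕ} (hk : 1 ≤ k) {s : UnitIco}
    (hs : itinerary (rotation α) (letter α) n s
      = itinerary (rotation α) (letter α) n ((rotation α)^[k] s)) :
    c ^ 2 * n / 2 ≤ k := by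
  obtain ⟨q, q', hq, hqn, hqn', -⟩ := exists_isConsecutive hα (n := ⌊c * n⌋₊)
    ((Nat.one_le_floor_iff _).2 hn)
  have hq1 := hq.one_le
  have hlt := hq.lt
  have hcn : (⌊c * n⌋₊ : ℝ) ≤ c * n := Nat.floor_le (by linarith)
  have hcn' : c * n < q' := (Nat.floor_lt (by linarith)).1 hqn'
  have hθ := nearestDist_pos hα hq1
  have hqc : (q : ℝ) ≤ c * n := le_trans (by exact_mod_cast hqn) hcn
  have hqθ := h q hq1
  have hq'θ := hq.mul_dist_le_one
  -- From q'‖qα‖ ≤ 1 and c ≤ q‖qα‖ follows cq' ≤ q ≤ cn, so level n already resolves lengths below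
  -- 2‖qα‖.
  have hq'n : (q' : ℝ) ≤ n := by
    have : c * q' ≤ c * n := by
      by_contra! hcc
      have : c * q' * nearestDist (q * α) ≤ c := by nlinarith
      nlinarith
    exact le_of_mul_le_mul_left this hc
  have hdist := hq.abs_sub_lt hα h0 h1 (by exact_mod_cast hq'n) hs
  have hk' := nearestDist_le_rotation_iterate (α := α) k s
  have h2 : nearestDist (k * α) < 2 * nearestDist (q * α) := by
    have := hq.dist_lt
    linarith
  have h3 := h k hk
  have hkpos : (0 : ℝ) < k := by exact_mod_cast hk
  have h4 : c ≤ k * (2 * nearestDist (q * α)) := h3.trans (by gcongr)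
  have h5 : c * n * nearestDist (q * α) ≤ 1 := by nlinarith
  have hcnpos : 0 < c * n := by linarith
  calc c ^ 2 * n / 2 = (c * n) * c / 2 := by ring
    _ ≤ (c * n) * (k * (2 * nearestDist (q * α))) / 2 := by gcongr
    _ = k * (c * n * nearestDist (q * α)) := by ring
    _ ≤ k * 1 := by gcongr
    _ = k := mul_one _

/-- For badly approximable `α`, recurrence times of words of length `n` are at most linear. -/
theorem upper_bound_of_badlyApproximable (h0 : 0 < α) (h1 : α < 1) {c : ℝ}
    (hc : 0 < c) (h : ∀ k : ℕ, 1 ≤ k → c ≤ k * nearestDist (k * α)) {n : ℕ} (hn : 1 ≤ n)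
    (t : UnitIco) :
    ∃ k : ℕ, 1 ≤ k ∧ (k : ℝ) ≤ n / c + 1 ∧ ∃ s,
      itinerary (rotation α) (letter α) n s = itinerary (rotation α) (letter α) n t ∧
      itinerary (rotation α) (letter α) n ((rotation α)^[k] s)
        = itinerary (rotation α) (letter α) n t := by
  have hnpos : (0 : ℝ) < n := by exact_mod_cast hn
  have hn1 : (1 : ℝ) ≤ n := by exact_mod_cast hn
  have hc1 : c ≤ 1 / 2 := by
    have := h 1 le_rfl
    have h2 := abs_sub_round ((1 : ℕ) * α : ℝ)
    unfold nearestDist at this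
    push_cast at this h2
    linarith
  have hdist : ∀ i : ℕ, 1 ≤ i → i ≤ n → ∀ m : ℤ, c / n ≤ |i * α - m| := by
    intro i hi1 hin m
    refine le_trans ?_ (nearestDist_le _ m)
    rw [div_le_iff₀ hnpos, mul_comm]
    exact (h i hi1).trans (mul_le_mul_of_nonneg_right (by exact_mod_cast hin) (nearestDist_nonneg _))
  -- The nearest cut a at or to the left of t; index 0 supplies the endpoint 0. Distinct cuts are at
  -- least c/n apart, so the atom contains [a, a + c/n).
  obtain ⟨j, hj, hjmax⟩ := Finset.exists_max_image
    ((Finset.range (n + 1)).filter fun i : ℕ => Int.fract (-(i * α)) ≤ (t : ℝ))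
    (fun i : ℕ => Int.fract (-(i * α))) ⟨0, by simpa using t.2.1⟩
  simp only [Finset.mem_filter, Finset.mem_range] at hj hjmax
  set a := Int.fract (-(j * α)) with ha
  have ha0 : 0 ≤ a := Int.fract_nonneg _
  have hasum : a = -(j * α) - ⌊-(j * α)⌋ := rfl
  have hsame : ∀ s : UnitIco, a ≤ (s : ℝ) → (s : ℝ) < a + c / n →
      itinerary (rotation α) (letter α) n s = itinerary (rotation α) (letter α) n t := by
    intro s has hsa
    rcases le_total s t with hst | hts
    · refine itinerary_eq_of_forall_notMem h0 h1 hst fun i hi1 hin m hm1 hm2 => ?_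
      have hfr : Int.fract (-(i * α)) = m - i * α := by
        rw [Int.fract_eq_iff]
        exact ⟨by linarith, by linarith [t.2.2], -m, by push_cast; ring⟩
      have := hjmax i ⟨by omega, by rw [hfr]; exact hm2⟩
      rw [hfr] at this
      linarith
    · refine (itinerary_eq_of_forall_notMem h0 h1 hts fun i hi1 hin m hm1 hm2 => ?_).symm
      have hlow : a < m - i * α := lt_of_le_of_lt hj.2 hm1
      rcases lt_trichotomy i j with hij | rfl | hij
      · have := hdist (j - i) (by omega) (by omega) (-⌊-(j * α)⌋ - m)
        rw [Nat.cast_sub hij.le] at this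
        push_cast at this
        have e : ((j : ℝ) - i) * α - (-⌊-(j * α)⌋ - m) = m - i * α - a := by rw [hasum]; ring
        rw [e, abs_of_pos (by linarith)] at this
        linarith
      · have e1 : (0 : ℝ) < (m + ⌊-(i * α)⌋ : ℤ) := by push_cast; linarith
        have e2 : ((m + ⌊-(i * α)⌋ : ℤ) : ℝ) < 1 := by
          push_cast
          have : c / n ≤ c := div_le_self hc.le hn1
          linarith
        have e1' : 0 < m + ⌊-(i * α)⌋ := by exact_mod_cast e1
        have e2' : m + ⌊-(i * α)⌋ < 1 := by exact_mod_cast e2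
        omega
      · have := hdist (i - j) (by omega) (by omega) (m + ⌊-(j * α)⌋)
        rw [Nat.cast_sub hij.le] at this
        push_cast at this
        have e : ((i : ℝ) - j) * α - (m + ⌊-(j * α)⌋) = -(m - i * α - a) := by rw [hasum]; ring
        rw [e, abs_neg, abs_of_pos (by linarith)] at this
        linarith
  have ha1 : a + c / n ≤ 1 := by
    rcases Nat.eq_zero_or_pos j with hj0 | hj0
    · have : a = 0 := by rw [ha, hj0]; simp
      rw [this, zero_add, div_le_one hnpos]
      linarith
    · have := hdist j hj0 (by omega) (-1 - ⌊-(j * α)⌋)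
      push_cast at this
      have e : (j : ℝ) * α - (-1 - ⌊-(j * α)⌋) = 1 - a := by rw [hasum]; ring
      rw [e, abs_of_pos (by rw [ha]; linarith [Int.fract_lt_one (-(j * α))])] at this
      linarith
  have hcn : 0 < c / n := by positivity
  obtain ⟨k, hk1, hk2, hk3⟩ := exists_nearestDist_lt (α := α) hcn
  refine ⟨k, hk1, by rwa [one_div_div] at hk2, ?_⟩
  unfold nearestDist at hk3
  -- A displacement smaller than c/n stays in the atom: start at a if it is to the right, end at a
  -- if it is to the left.
  rcases le_or_gt 0 (k * α - round ((k : ℝ) * α)) with he | he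
  · rw [abs_of_nonneg he] at hk3
    refine ⟨⟨a, ha0, by linarith⟩, hsame _ le_rfl (by simpa using hcn), hsame _ ?_ ?_⟩ <;>
    rw [rotation_iterate_eq (x := a + (k * α - round ((k : ℝ) * α))) (round ((k : ℝ) * α))
        (by linarith) (by linarith) (by ring)]
    <;> linarith
  · rw [abs_of_neg he] at hk3
    refine ⟨⟨a - (k * α - round ((k : ℝ) * α)), by linarith, by linarith⟩,
      hsame _ (by simp only; linarith) (by simp only; linarith), hsame _ ?_ ?_⟩ <;>
    rw [rotation_iterate_eq (x := a) (round ((k : ℝ) * α))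
        (by linarith) (by linarith) (by simp only; ring)] <;> linarith

/-! ### The crossing arc and recurrence times. -/

section Arc

/-- The arc of points that the rotation by `qα` moves across `0`. -/
noncomputable def crossingArc (α : ℝ) (q : ℕ) : Set UnitIco :=
  if 0 < q * α - round (q * α) then {t | 1 - nearestDist (q * α) ≤ (t : ℝ)}
  else {t | (t : ℝ) < nearestDist (q * α)}

variable {q : ℕ}

theorem measurableSet_crossingArc : MeasurableSet (crossingArc α q) := by
  unfold crossingArc
  split_ifs
  · exact measurableSet_le measurable_const measurable_subtype_coe
  · exact measurableSet_lt measurable_subtype_coe measurable_const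

theorem abs_sub_lt_of_mem_crossingArc {s t : UnitIco} (hs : s ∈ crossingArc α q)
    (ht : t ∈ crossingArc α q) : |(t : ℝ) - s| < nearestDist (q * α) := by
  have := s.2.1
  have := s.2.2
  have := t.2.1
  have := t.2.2
  rw [abs_lt]
  unfold crossingArc at hs ht
  split_ifs at hs ht <;> simp only [mem_ofPred_eq] at hs ht <;> constructor <;> linarith

theorem rotation_iterate_of_notMem_crossingArc {t : UnitIco} (ht : t ∉ crossingArc α q) :
    (((rotation α)^[q] t : UnitIco) : ℝ) = t + (q * α - round (q * α)) := by
  have := t.2.1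
  have := t.2.2
  unfold crossingArc at ht
  split_ifs at ht with h <;> simp only [mem_ofPred_eq, nearestDist] at ht
  · rw [abs_of_pos h] at ht
    exact rotation_iterate_eq (round (q * α)) (by linarith) (by linarith) (by ring)
  · rw [abs_of_nonpos (not_lt.1 h)] at ht
    exact rotation_iterate_eq (round (q * α)) (by linarith) (by linarith) (by ring)

/-- The letters at times `0` and `q` agree unless `t` or its image lies in the crossing arc. -/
theorem letter_rotation_iterate (h0 : 0 < α) (h1 : α < 1) {t : UnitIco}
    (ht : t ∉ crossingArc α q) (ht' : rotation α t ∉ crossingArc α q) :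
    letter α ((rotation α)^[q] t) = letter α t := by
  -- Both t and its image move by the same real amount in q steps, so the one-step increments at
  -- times 0 and q agree, and so do the letters.
  have e1 := rotation_iterate_of_notMem_crossingArc ht
  have e2 := rotation_iterate_of_notMem_crossingArc ht'
  rw [← Function.iterate_succ_apply, Function.iterate_succ_apply'] at e2
  rw [letter_eq_iff]
  constructor
  · intro h
    by_contra! h'
    rw [rotation_coe_of_lt h0 h, rotation_coe_of_le h1 h'] at e2
    linarith
  · intro h
    by_contra! h'
    rw [rotation_coe_of_le h1 h', rotation_coe_of_lt h0 h] at e2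
    linarith

theorem itinerary_rotation_iterate (h0 : 0 < α) (h1 : α < 1) {n : ℕ} {t : UnitIco}
    (ht : ∀ i ≤ n, (rotation α)^[i] t ∉ crossingArc α q) :
    itinerary (rotation α) (letter α) n ((rotation α)^[q] t)
      = itinerary (rotation α) (letter α) n t := by
  rw [itinerary_eq_iff]
  intro i hi
  rw [← Function.iterate_add_apply, add_comm, Function.iterate_add_apply]
  refine letter_rotation_iterate h0 h1 (ht i hi.le) ?_
  rw [← Function.iterate_succ_apply' (rotation α) i t]
  exact ht (i + 1) hi

/-- A word reaching time i + q detects the arc: differences of s and t persist, so if s translated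
without wrapping, t would too and would leave [0,1). -/
theorem mem_crossingArc_of_itinerary_eq (h0 : 0 < α) (h1 : α < 1) {n i : ℕ}
    (hi : i + q ≤ n) {s t : UnitIco}
    (h : itinerary (rotation α) (letter α) n s = itinerary (rotation α) (letter α) n t)
    (ht : (rotation α)^[i] t ∈ crossingArc α q) : (rotation α)^[i] s ∈ crossingArc α q := by
  by_contra hs
  have e1 := rotation_iterate_sub h0 h1 (itinerary_eq_iff.1 h) (i := i) (by omega)
  have e2 := rotation_iterate_sub h0 h1 (itinerary_eq_iff.1 h) hi
  have e3 := rotation_iterate_of_notMem_crossingArc hs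
  rw [add_comm i q, Function.iterate_add_apply, Function.iterate_add_apply, e3] at e2
  have a1 := ((rotation α)^[q] ((rotation α)^[i] t)).2.1
  have a2 := ((rotation α)^[q] ((rotation α)^[i] t)).2.2
  unfold crossingArc at ht
  split_ifs at ht with hh <;> simp only [mem_ofPred_eq, nearestDist] at ht
  · rw [abs_of_pos hh] at ht
    linarith
  · rw [abs_of_nonpos (not_lt.1 hh)] at ht
    linarith

/-- Points whose orbit meets the crossing arc of `q` early have recurrence at least `q'`. -/
theorem IsConsecutive.le_wordRecurrence {q' : ℕ} (hq : IsConsecutive α q q') (h0 : 0 < α)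
    (h1 : α < 1) {n i : ℕ} (hi : i + q ≤ n) {t : UnitIco}
    (ht : (rotation α)^[i] t ∈ crossingArc α q) :
    (q' : ℕ∞) ≤ wordRecurrence (rotation α) (letter α) n
      (itinerary (rotation α) (letter α) n t) := by
  refine le_iInf₂ fun k hk => ?_
  obtain ⟨hk1, y, h, h'⟩ := hk
  -- Both occurrences visit the arc at offset i. Its width forces ‖kα‖ < ‖qα‖, hence k ≥ q'.
  have m1 := mem_crossingArc_of_itinerary_eq h0 h1 hi h ht
  have m2 := mem_crossingArc_of_itinerary_eq h0 h1 hi h' ht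
  rw [← Function.iterate_add_apply, add_comm, Function.iterate_add_apply] at m2
  have hlt := (nearestDist_le_rotation_iterate (α := α) k ((rotation α)^[i] y)).trans_lt
    (abs_sub_lt_of_mem_crossingArc m1 m2)
  have : q' ≤ k := by
    by_contra! hkq
    exact absurd (hq.le_dist k hk1 hkq) (not_le.2 hlt)
  exact_mod_cast this

theorem IsConsecutive.pairwise_disjoint {q' : ℕ} (hq : IsConsecutive α q q') :
    ∀ i j : ℕ, i < j → j < i + q' →
      Disjoint ((rotation α)^[i] ⁻¹' crossingArc α q) ((rotation α)^[j] ⁻¹' crossingArc α q) := by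
  intro i j hij hjq
  rw [Set.disjoint_left]
  intro t hi hj
  obtain ⟨k, rfl⟩ := Nat.exists_eq_add_of_lt hij
  rw [mem_preimage, show i + k + 1 = (k + 1) + i by ring, Function.iterate_add_apply] at hj
  have hlt := (nearestDist_le_rotation_iterate (α := α) (k + 1) ((rotation α)^[i] t)).trans_lt
    (abs_sub_lt_of_mem_crossingArc hi hj)
  exact absurd (hq.le_dist (k + 1) (by omega) (by omega)) (not_le.2 hlt)

end Arc

end

section

/-! ### Monotonicity of the rates and the zero-one law. -/

section Rates

variable {X : Type*}

theorem tendsto_one_add_inv_natCast :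
    Tendsto (fun n : ℕ => 1 + (n : ℝ≥0∞)⁻¹) atTop (nhds 1) := by
  simpa using ENNReal.tendsto_inv_nat_nhds_zero.const_add 1

theorem div_natCast_eq {n : ℕ} (hn : 1 ≤ n) (a : ℝ≥0∞) :
    a / n = (1 + (n : ℝ≥0∞)⁻¹) * (a / ((n + 1 : ℕ) : ℝ≥0∞)) := by
  have h0 : (n : ℝ≥0∞) ≠ 0 := by exact_mod_cast (by omega : n ≠ 0)
  have h1 : ((n + 1 : ℕ) : ℝ≥0∞) ≠ 0 := by exact_mod_cast (by omega : n + 1 ≠ 0)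
  have e : (1 + (n : ℝ≥0∞)⁻¹) = ((n + 1 : ℕ) : ℝ≥0∞) * (n : ℝ≥0∞)⁻¹ := by
    push_cast
    rw [add_mul, ENNReal.mul_inv_cancel h0 (ENNReal.natCast_ne_top n), one_mul]
  rw [e, div_eq_mul_inv, div_eq_mul_inv]
  calc a * (n : ℝ≥0∞)⁻¹ = a * (n : ℝ≥0∞)⁻¹ * 1 := (mul_one _).symm
    _ = a * (n : ℝ≥0∞)⁻¹ * (((n + 1 : ℕ) : ℝ≥0∞) * ((n + 1 : ℕ) : ℝ≥0∞)⁻¹) := by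
      rw [ENNReal.mul_inv_cancel h1 (ENNReal.natCast_ne_top _)]
    _ = _ := by ring

variable {τ : ℕ → X → ℕ∞} {T : X → X}

/-- The shift of the level costs only the factor (n + 1)/n, which tends to 1. -/
theorem limsup_div_map_le (h : ∀ n x, τ n (T x) ≤ τ (n + 1) x) (x : X) :
    limsup (fun n : ℕ => (τ n (T x) : ℝ≥0∞) / n) atTop
      ≤ limsup (fun n : ℕ => (τ n x : ℝ≥0∞) / n) atTop := by
  rw [← limsup_nat_add (fun n : ℕ => (τ n x : ℝ≥0∞) / n) 1]
  have hρ := tendsto_one_add_inv_natCast.limsup_eq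
  calc _ ≤ limsup ((fun n : ℕ => 1 + (n : ℝ≥0∞)⁻¹) *
        fun n : ℕ => (τ (n + 1) x : ℝ≥0∞) / ((n + 1 : ℕ) : ℝ≥0∞)) atTop := by
        refine limsup_le_limsup ?_
        filter_upwards [eventually_ge_atTop 1] with n hn
        rw [Pi.mul_apply, ← div_natCast_eq hn]
        gcongr
        exact_mod_cast h n x
    _ ≤ _ := by
        refine (ENNReal.limsup_mul_le' ?_ ?_).trans ?_ <;> rw [hρ] <;> simp

theorem liminf_div_map_le (h : ∀ n x, τ n (T x) ≤ τ (n + 1) x) (x : X) :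
    liminf (fun n : ℕ => (τ n (T x) : ℝ≥0∞) / n) atTop
      ≤ liminf (fun n : ℕ => (τ n x : ℝ≥0∞) / n) atTop := by
  rw [← liminf_nat_add (fun n : ℕ => (τ n x : ℝ≥0∞) / n) 1]
  have hρ := tendsto_one_add_inv_natCast.limsup_eq
  calc _ ≤ liminf ((fun n : ℕ => 1 + (n : ℝ≥0∞)⁻¹) *
        fun n : ℕ => (τ (n + 1) x : ℝ≥0∞) / ((n + 1 : ℕ) : ℝ≥0∞)) atTop := by
        refine liminf_le_liminf ?_
        filter_upwards [eventually_ge_atTop 1] with n hn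
        rw [Pi.mul_apply, ← div_natCast_eq hn]
        gcongr
        exact_mod_cast h n x
    _ ≤ _ := by
        refine (ENNReal.liminf_mul_le ?_ ?_).trans ?_ <;> rw [hρ] <;> simp

variable [MeasurableSpace X] {μ : Measure X}

theorem le_measure_setOf_frequently [IsFiniteMeasure μ] {E : ℕ → Set X}
    (hE : ∀ n, MeasurableSet (E n)) {δ : ℝ≥0∞} (h : ∃ᶠ n in atTop, δ ≤ μ (E n)) :
    δ ≤ μ {x | ∃ᶠ n in atTop, x ∈ E n} := by
  have e : {x | ∃ᶠ n in atTop, x ∈ E n} = ⋂ N : ℕ, ⋃ n ≥ N, E n := by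
    ext x; simp [frequently_atTop]
  rw [e]
  have ht := tendsto_measure_iInter_atTop (μ := μ) (s := fun N : ℕ => ⋃ n ≥ N, E n)
    (fun N => (MeasurableSet.iUnion fun n => MeasurableSet.iUnion fun _ => hE n).nullMeasurableSet)
    (fun M N hMN => biUnion_mono (fun n (hn : N ≤ n) => hMN.trans hn) fun _ _ => subset_rfl)
    ⟨0, measure_ne_top _ _⟩
  refine ge_of_tendsto' ht fun N => ?_
  obtain ⟨n, hn, hδ⟩ := frequently_atTop.1 h N
  exact hδ.trans (measure_mono (subset_biUnion_of_mem (u := E) hn))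

/-- The limsup of the events has measure at least δ and lies in A, which rules out the null
alternative given by ergodicity. -/
theorem ae_mem_of_frequently [IsProbabilityMeasure μ] (hT : Ergodic T μ) {A : Set X}
    (hA : MeasurableSet A) (hTA : T ⁻¹' A ⊆ A) {E : ℕ → Set X} (hE : ∀ n, MeasurableSet (E n))
    (hEA : ∀ x, (∃ᶠ n in atTop, x ∈ E n) → x ∈ A) {δ : ℝ≥0∞} (hδ : δ ≠ 0)
    (h : ∃ᶠ n in atTop, δ ≤ μ (E n)) : ∀ᵐ x ∂μ, x ∈ A := by
  rcases hT.ae_empty_or_univ_of_preimage_ae_le hA.nullMeasurableSet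
    (Eventually.of_forall fun x hx => hTA hx) with h0 | h1
  · have h2 := (le_measure_setOf_frequently hE h).trans (measure_mono (fun x hx => hEA x hx))
    rw [measure_congr h0, measure_empty] at h2
    exact absurd (le_antisymm h2 bot_le) hδ
  · exact eventuallyEq_univ.1 h1

theorem measurable_coe_div (hτ : ∀ n, Measurable (τ n)) (n : ℕ) :
    Measurable fun x => (τ n x : ℝ≥0∞) / n :=
  ((measurable_from_top (f := fun k : ℕ∞ => (k : ℝ≥0∞))).comp (hτ n)).div_const _

theorem ae_le_limsup_div [IsProbabilityMeasure μ] (hT : Ergodic T μ) (hτ : ∀ n, Measurable (τ n))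
    (h : ∀ n x, τ n (T x) ≤ τ (n + 1) x) {K δ : ℝ≥0∞} (hδ : δ ≠ 0)
    (hK : ∃ᶠ n : ℕ in atTop, δ ≤ μ {x | K ≤ (τ n x : ℝ≥0∞) / n}) :
    ∀ᵐ x ∂μ, K ≤ limsup (fun n : ℕ => (τ n x : ℝ≥0∞) / n) atTop := by
  refine ae_mem_of_frequently (A := {x | K ≤ limsup (fun n : ℕ => (τ n x : ℝ≥0∞) / n) atTop})
    hT ?_ (fun x hx => le_trans hx (limsup_div_map_le h x))
    (fun n => measurableSet_le measurable_const (measurable_coe_div hτ n))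
    (fun x (hx : ∃ᶠ n : ℕ in atTop, K ≤ (τ n x : ℝ≥0∞) / n) =>
      le_limsup_of_frequently_le hx (by isBoundedDefault)) hδ hK
  exact measurableSet_le measurable_const (.limsup (measurable_coe_div hτ))

theorem ae_liminf_div_le [IsProbabilityMeasure μ] (hT : Ergodic T μ) (hτ : ∀ n, Measurable (τ n))
    (h : ∀ n x, τ n (T x) ≤ τ (n + 1) x) {K δ : ℝ≥0∞} (hδ : δ ≠ 0)
    (hK : ∃ᶠ n : ℕ in atTop, δ ≤ μ {x | (τ n x : ℝ≥0∞) / n ≤ K}) :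
    ∀ᵐ x ∂μ, liminf (fun n : ℕ => (τ n x : ℝ≥0∞) / n) atTop ≤ K := by
  have hlim : Measurable fun x => liminf (fun n : ℕ => (τ n x : ℝ≥0∞) / n) atTop :=
    .liminf (measurable_coe_div hτ)
  have key := hT.ae_empty_or_univ_of_ae_le_preimage
    (s := {x | liminf (fun n : ℕ => (τ n x : ℝ≥0∞) / n) atTop ≤ K})
    (measurableSet_le hlim measurable_const).nullMeasurableSet
    (Eventually.of_forall fun x hx => (liminf_div_map_le h x).trans hx)
  rcases key with h0 | h1
  · have h2 : δ ≤ μ {x | liminf (fun n : ℕ => (τ n x : ℝ≥0∞) / n) atTop ≤ K} :=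
      (le_measure_setOf_frequently
      (fun n => measurableSet_le (measurable_coe_div hτ n) measurable_const) hK).trans
      (measure_mono fun x (hx : ∃ᶠ n : ℕ in atTop, (τ n x : ℝ≥0∞) / n ≤ K) =>
        liminf_le_of_frequently_le hx (by isBoundedDefault))
    rw [measure_congr h0, measure_empty] at h2
    exact absurd (le_antisymm h2 bot_le) hδ
  · exact eventuallyEq_univ.1 h1

end Rates

/-! ### Ergodicity of the rotation and measures of the events. -/

section Lebesgue

theorem measurableEmbedding_coe_unitIco : MeasurableEmbedding (Subtype.val : UnitIco → ℝ) :=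
  MeasurableEmbedding.subtype_coe measurableSet_Ico

theorem lebesgueIco_apply (s : Set UnitIco) :
    lebesgueIco s = volume (Subtype.val '' s : Set ℝ) :=
  measurableEmbedding_coe_unitIco.comap_apply _ _

theorem lebesgueIco_preimage (s : Set ℝ) :
    lebesgueIco (Subtype.val ⁻¹' s) = volume (Ico 0 1 ∩ s) := by
  rw [lebesgueIco_apply, Subtype.image_preimage_coe]

instance : IsProbabilityMeasure lebesgueIco :=
  ⟨by rw [← preimage_univ, lebesgueIco_preimage]; simp⟩

theorem lebesgueIco_crossingArc (α : ℝ) (q : ℕ) :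
    lebesgueIco (crossingArc α q) = ENNReal.ofReal (nearestDist (q * α)) := by
  have h0 := nearestDist_nonneg (q * α)
  have h1 : nearestDist (q * α) ≤ 1 / 2 := abs_sub_round _
  unfold crossingArc
  split_ifs
  · change lebesgueIco (Subtype.val ⁻¹' Ici (1 - nearestDist (q * α))) = _
    rw [lebesgueIco_preimage]
    have : Ico (0 : ℝ) 1 ∩ Ici (1 - nearestDist (q * α)) = Ico (1 - nearestDist (q * α)) 1 := by
      ext x; simp only [mem_inter_iff, mem_Ico, mem_Ici]
      exact ⟨fun h => ⟨h.2, h.1.2⟩, fun h => ⟨⟨by linarith [h.1], h.2⟩, h.1⟩⟩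
    rw [this, Real.volume_Ico]
    congr 1; ring
  · change lebesgueIco (Subtype.val ⁻¹' Iio (nearestDist (q * α))) = _
    rw [lebesgueIco_preimage]
    have : Ico (0 : ℝ) 1 ∩ Iio (nearestDist (q * α)) = Ico 0 (nearestDist (q * α)) := by
      ext x; simp only [mem_inter_iff, mem_Ico, mem_Iio]
      exact ⟨fun h => ⟨h.1.1, h.2⟩, fun h => ⟨⟨h.1, by linarith [h.2]⟩, h.2⟩⟩
    rw [this, Real.volume_Ico, sub_zero]

variable {α : ℝ}

theorem measurable_rotation : Measurable (rotation α) :=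
  Measurable.subtype_mk (measurable_fract.comp (measurable_subtype_coe.add_const α))

theorem ergodic_rotation (hα : Irrational α) : Ergodic (rotation α) lebesgueIco := by
  have hcirc : Ergodic (fun x : AddCircle (1 : ℝ) => x + (α : AddCircle (1 : ℝ))) volume := by
    rw [AddCircle.ergodic_add_right, ← AddCircle.denseRange_zsmul_iff,
      AddCircle.denseRange_zsmul_coe_iff, div_one]
    exact hα
  -- Ergodicity is transported from the circle by this identification with [0,1).
  set g : AddCircle (1 : ℝ) → UnitIco := fun x =>
    ⟨AddCircle.measurableEquivIco 1 0 x, (AddCircle.measurableEquivIco 1 0 x).2.1, by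
      simpa using (AddCircle.measurableEquivIco 1 0 x).2.2⟩ with hg
  have hgm : Measurable g := Measurable.subtype_mk
    (measurable_subtype_coe.comp (AddCircle.measurableEquivIco 1 0).measurable)
  have hcoe : ∀ x : ℝ, (g (x : AddCircle (1 : ℝ)) : ℝ) = Int.fract x := by
    intro x
    have : (g (x : AddCircle (1 : ℝ)) : ℝ) = AddCircle.equivIco 1 0 (x : AddCircle (1 : ℝ)) := rfl
    rw [this, AddCircle.coe_equivIco_mk_apply]
    simp
  have hmp : MeasurePreserving g volume lebesgueIco := by
    refine ⟨hgm, ?_⟩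
    have h1 := (AddCircle.measurePreserving_mk (1 : ℝ) 0).map_eq
    have hr : volume.restrict (Ico (0 : ℝ) 1) = Measure.map Subtype.val lebesgueIco := by
      rw [lebesgueIco, measurableEmbedding_coe_unitIco.map_comap, Subtype.range_coe]
    rw [← h1, Measure.map_map hgm AddCircle.measurable_mk', zero_add,
      ← Measure.restrict_congr_set (Ico_ae_eq_Ioc (μ := volume) (a := (0 : ℝ)) (b := 1)),
      hr,
      Measure.map_map (hgm.comp AddCircle.measurable_mk') measurable_subtype_coe]
    have : (g ∘ (fun x : ℝ => (x : AddCircle (1 : ℝ)))) ∘ (Subtype.val : UnitIco → ℝ) = id := by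
      funext t
      apply Subtype.ext
      change (g ((t : ℝ) : AddCircle (1 : ℝ)) : ℝ) = t
      rw [hcoe, Int.fract_eq_self.2 t.2]
    exact (congrArg (fun f => Measure.map f lebesgueIco) this).trans Measure.map_id
  refine hmp.ergodic_of_ergodic_semiconj hcirc measurable_rotation fun x => ?_
  induction x using QuotientAddGroup.induction_on with
  | H x =>
  apply Subtype.ext
  have h1 : (g ((x : AddCircle (1 : ℝ)) + (α : AddCircle (1 : ℝ))) : ℝ) = Int.fract (x + α) := by
    rw [← AddCircle.coe_add, hcoe]
  have h2 : (rotation α (g (x : AddCircle (1 : ℝ))) : ℝ) = Int.fract (Int.fract x + α) := by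
    change Int.fract ((g (x : AddCircle (1 : ℝ)) : ℝ) + α) = _
    rw [hcoe]
  refine h1.trans (Eq.trans ?_ h2.symm)
  rw [Int.fract_eq_fract]
  exact ⟨⌊x⌋, by rw [Int.fract]; ring⟩

theorem measurable_letter : Measurable (letter α) :=
  Measurable.ite (measurableSet_lt measurable_subtype_coe measurable_const) measurable_const
    measurable_const

theorem measurable_itinerary {X : Type*} [MeasurableSpace X] {T : X → X} {f : X → Fin 2}
    (hT : Measurable T) (hf : Measurable f) (n : ℕ) : Measurable (itinerary T f n) :=
  measurable_pi_lambda _ fun i => hf.comp (hT.iterate i)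

/-- The recurrence time of the atom of level `n` containing `t`. -/
noncomputable def rotationRecurrence (α : ℝ) (n : ℕ) (t : UnitIco) : ℕ∞ :=
  wordRecurrence (rotation α) (letter α) n (itinerary (rotation α) (letter α) n t)

theorem measurable_rotationRecurrence (n : ℕ) : Measurable (rotationRecurrence α n) :=
  (measurable_of_countable _).comp (measurable_itinerary measurable_rotation measurable_letter n)

theorem rotationRecurrence_map_le (n : ℕ) (t : UnitIco) :
    rotationRecurrence α n (rotation α t) ≤ rotationRecurrence α (n + 1) t :=
  wordRecurrence_image_le _ _ _ _

theorem lowerRate_rotation (t : UnitIco) :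
    lowerRate (rotation α) (rotationPartition α) t
      = liminf (fun n : ℕ => (rotationRecurrence α n t : ℝ≥0∞) / n) atTop := by
  rw [rotationPartition_eq]
  simp only [lowerRate, setRecurrence_atomOf, rotationRecurrence]

theorem upperRate_rotation (t : UnitIco) :
    upperRate (rotation α) (rotationPartition α) t
      = limsup (fun n : ℕ => (rotationRecurrence α n t : ℝ≥0∞) / n) atTop := by
  rw [rotationPartition_eq]
  simp only [upperRate, setRecurrence_atomOf, rotationRecurrence]

theorem lebesgueIco_preimage_crossingArc (hα : Irrational α) (q i : ℕ) :
    lebesgueIco ((rotation α)^[i] ⁻¹' crossingArc α q)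
      = ENNReal.ofReal (nearestDist (q * α)) := by
  rw [((ergodic_rotation hα).toMeasurePreserving.iterate i).measure_preimage
    measurableSet_crossingArc.nullMeasurableSet, lebesgueIco_crossingArc]

/-- Discard the n + 1 preimages of the arc, each of measure ‖qα‖. -/
theorem measure_rotationRecurrence_le (hα : Irrational α) (h0 : 0 < α) (h1 : α < 1) {q : ℕ}
    (hq : 1 ≤ q) (n : ℕ) :
    ENNReal.ofReal (1 - (n + 1) * nearestDist (q * α))
      ≤ lebesgueIco {t | rotationRecurrence α n t ≤ q} := by
  set A := ⋃ i ∈ Finset.range (n + 1), (rotation α)^[i] ⁻¹' crossingArc α q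
  have hA : lebesgueIco A ≤ ENNReal.ofReal ((n + 1) * nearestDist (q * α)) := by
    refine (measure_biUnion_finset_le _ _).trans ?_
    simp only [lebesgueIco_preimage_crossingArc hα, Finset.sum_const, Finset.card_range,
      nsmul_eq_mul]
    rw [ENNReal.ofReal_mul (by positivity)]
    gcongr
    rw [← ENNReal.ofReal_natCast]
    push_cast
    rfl
  have hAm : MeasurableSet A := Finset.measurableSet_biUnion _ fun i _ =>
    (measurable_rotation.iterate i) measurableSet_crossingArc
  have hsub : Aᶜ ⊆ {t | rotationRecurrence α n t ≤ q} := by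
    intro t ht
    have ht' : ∀ i ≤ n, (rotation α)^[i] t ∉ crossingArc α q := by
      intro i hi hmem
      exact ht (mem_biUnion (Finset.mem_coe.2 (Finset.mem_range.2 (by omega))) hmem)
    exact wordRecurrence_le hq rfl (itinerary_rotation_iterate h0 h1 ht')
  refine le_trans ?_ (measure_mono hsub)
  rw [prob_compl_eq_one_sub hAm, ENNReal.ofReal_sub _ (by
    have := nearestDist_nonneg (q * α); positivity), ENNReal.ofReal_one]
  gcongr

/-- The n - q + 1 preimages of the arc all force τ ≥ q'; n < q + q' makes them disjoint, so their
measures add. -/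
theorem IsConsecutive.le_measure_rotationRecurrence (hα : Irrational α) (h0 : 0 < α) (h1 : α < 1)
    {q q' : ℕ} (h : IsConsecutive α q q') {n : ℕ} (hqn : q ≤ n) (hn : n < q + q') :
    ENNReal.ofReal ((n - q + 1) * nearestDist (q * α))
      ≤ lebesgueIco {t | (q' : ℕ∞) ≤ rotationRecurrence α n t} := by
  set A := ⋃ i ∈ Finset.range (n - q + 1), (rotation α)^[i] ⁻¹' crossingArc α q
  have hA : lebesgueIco A = ENNReal.ofReal ((n - q + 1) * nearestDist (q * α)) := by
    rw [measure_biUnion_finset]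
    · simp only [lebesgueIco_preimage_crossingArc hα, Finset.sum_const, Finset.card_range,
        nsmul_eq_mul]
      have hc : ((n - q + 1 : ℕ) : ℝ) = n - q + 1 := by rw [Nat.cast_add, Nat.cast_sub hqn]; simp
      rw [← hc, ENNReal.ofReal_mul (by positivity), ENNReal.ofReal_natCast]
    · intro i hi j hj hij
      simp only [Finset.coe_range, mem_Iio] at hi hj
      rcases lt_or_gt_of_ne hij with hlt | hlt
      · exact h.pairwise_disjoint i j hlt (by omega)
      · exact (h.pairwise_disjoint j i hlt (by omega)).symm
    · exact fun i _ => (measurable_rotation.iterate i) measurableSet_crossingArc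
  rw [← hA]
  refine measure_mono fun t ht => ?_
  simp only [A, mem_iUnion, Finset.mem_range] at ht
  obtain ⟨i, hi, hmem⟩ := ht
  exact h.le_wordRecurrence h0 h1 (by omega) hmem

theorem ae_lowerRate_le (hα : Irrational α) (h0 : 0 < α) (h1 : α < 1) {K δ : ℝ} (hK : 0 ≤ K)
    (hδ : 0 < δ)
    (h : ∀ N : ℕ, ∃ n ≥ N, ∃ q : ℕ, 1 ≤ q ∧ (q : ℝ) ≤ K * n ∧
      (n + 1) * nearestDist (q * α) ≤ 1 - δ) :
    ∀ᵐ t ∂lebesgueIco, lowerRate (rotation α) (rotationPartition α) t ≤ ENNReal.ofReal K := by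
  simp only [lowerRate_rotation]
  refine ae_liminf_div_le (ergodic_rotation hα) measurable_rotationRecurrence
    rotationRecurrence_map_le (δ := ENNReal.ofReal δ) (by simpa using hδ) ?_
  rw [frequently_atTop]
  intro N
  obtain ⟨n, hn, q, hq, hqK, hle⟩ := h N
  refine ⟨n, hn, le_trans (ENNReal.ofReal_le_ofReal (by linarith))
    ((measure_rotationRecurrence_le hα h0 h1 hq n).trans (measure_mono fun t ht => ?_))⟩
  refine ENNReal.div_le_of_le_mul ?_
  have ht' : (rotationRecurrence α n t : ℝ≥0∞) ≤ ((q : ℕ∞) : ℝ≥0∞) := by exact_mod_cast ht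
  refine ht'.trans ?_
  rw [← ENNReal.ofReal_natCast n, ← ENNReal.ofReal_mul hK]
  simpa using ENNReal.ofReal_le_ofReal hqK

theorem ae_le_upperRate (hα : Irrational α) (h0 : 0 < α) (h1 : α < 1) {K δ : ℝ} (hK : 0 ≤ K)
    (hδ : 0 < δ)
    (h : ∀ N : ℕ, ∃ n ≥ N, ∃ q q' : ℕ, IsConsecutive α q q' ∧ q ≤ n ∧ n < q + q' ∧ K * n ≤ q' ∧
      δ ≤ (n - q + 1) * nearestDist (q * α)) :
    ∀ᵐ t ∂lebesgueIco, ENNReal.ofReal K ≤ upperRate (rotation α) (rotationPartition α) t := by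
  simp only [upperRate_rotation]
  refine ae_le_limsup_div (ergodic_rotation hα) measurable_rotationRecurrence
    rotationRecurrence_map_le (δ := ENNReal.ofReal δ) (by simpa using hδ) ?_
  rw [frequently_atTop]
  intro N
  obtain ⟨n, hn, q, q', hq, hqn, hnq, hKn, hle⟩ := h N
  refine ⟨n, hn, le_trans (ENNReal.ofReal_le_ofReal hle)
    ((hq.le_measure_rotationRecurrence hα h0 h1 hqn hnq).trans (measure_mono fun t ht => ?_))⟩
  have hn0 : n ≠ 0 := by have := hq.one_le; omega
  have ht' : ((q' : ℕ∞) : ℝ≥0∞) ≤ rotationRecurrence α n t := by exact_mod_cast ht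
  change ENNReal.ofReal K ≤ (rotationRecurrence α n t : ℝ≥0∞) / n
  rw [ENNReal.le_div_iff_mul_le (Or.inl (by exact_mod_cast hn0))
    (Or.inl (ENNReal.natCast_ne_top n))]
  refine le_trans ?_ ht'
  rw [← ENNReal.ofReal_natCast n, ← ENNReal.ofReal_mul hK]
  simpa using ENNReal.ofReal_le_ofReal hKn

end Lebesgue

/-! ### Recurrence rates of the rotation. -/

section Rotation

variable {α : ℝ}

theorem lowerRate_pos_of_bounded (hα : Irrational α) (h0 : 0 < α) (h1 : α < 1)
    (hb : BadlyApproximable α) (t : UnitIco) :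
    0 < lowerRate (rotation α) (rotationPartition α) t := by
  obtain ⟨c, hc, h⟩ := hb
  rw [lowerRate_rotation]
  have hpos : 0 < ENNReal.ofReal (c ^ 2 / 2) := by simpa using by positivity
  refine hpos.trans_le (le_liminf_of_le (by isBoundedDefault) ?_)
  filter_upwards [eventually_ge_atTop ⌈1 / c⌉₊, eventually_ge_atTop 1] with n hn hn1
  have hcn : 1 ≤ c * n := by
    have := (Nat.ceil_le.1 hn)
    rw [div_le_iff₀ hc] at this
    linarith
  rw [ENNReal.le_div_iff_mul_le (Or.inl (by exact_mod_cast (by omega : n ≠ 0)))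
    (Or.inl (ENNReal.natCast_ne_top n)), ← ENNReal.ofReal_natCast n,
    ← ENNReal.ofReal_mul (by positivity)]
  have key : ((⌈c ^ 2 / 2 * n⌉₊ : ℕ) : ℕ∞) ≤ rotationRecurrence α n t := by
    refine le_iInf₂ fun k hk => ?_
    obtain ⟨hk1, y, h2, h3⟩ := hk
    have := lower_bound_of_badlyApproximable hα h0 h1 hc h hcn hk1 (h2.trans h3.symm)
    exact_mod_cast Nat.ceil_le.2 (by linarith)
  have key' : (((⌈c ^ 2 / 2 * n⌉₊ : ℕ) : ℕ∞) : ℝ≥0∞) ≤ rotationRecurrence α n t := by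
    exact_mod_cast key
  refine le_trans ?_ key'
  simpa using ENNReal.ofReal_le_ofReal (Nat.le_ceil (c ^ 2 / 2 * n))

theorem upperRate_lt_top_of_bounded (h0 : 0 < α) (h1 : α < 1)
    (hb : BadlyApproximable α) (t : UnitIco) :
    upperRate (rotation α) (rotationPartition α) t < ⊤ := by
  obtain ⟨c, hc, h⟩ := hb
  rw [upperRate_rotation]
  refine lt_of_le_of_lt (limsup_le_of_le (a := ENNReal.ofReal (1 / c + 1)) (by isBoundedDefault) ?_)
    ENNReal.ofReal_lt_top
  filter_upwards [eventually_ge_atTop 1] with n hn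
  obtain ⟨k, hk1, hk2, s, h2, h3⟩ := upper_bound_of_badlyApproximable h0 h1 hc h hn t
  have key : rotationRecurrence α n t ≤ k := wordRecurrence_le hk1 h2 h3
  have key' : (rotationRecurrence α n t : ℝ≥0∞) ≤ ((k : ℕ∞) : ℝ≥0∞) := by exact_mod_cast key
  have hn1 : (1 : ℝ) ≤ n := by exact_mod_cast hn
  refine ENNReal.div_le_of_le_mul (key'.trans ?_)
  rw [← ENNReal.ofReal_natCast n, ← ENNReal.ofReal_mul (by positivity)]
  have : (k : ℝ) ≤ (1 / c + 1) * n := by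
    have e : (n : ℝ) / c = 1 / c * n := by ring
    linarith
  simpa using ENNReal.ofReal_le_ofReal this

theorem ae_lowerRate_lt_one (hα : Irrational α) (h0 : 0 < α) (h1 : α < 1) :
    ∀ᵐ t ∂lebesgueIco, lowerRate (rotation α) (rotationPartition α) t < 1 := by
  have := ae_lowerRate_le hα h0 h1 (K := 20 / 21) (δ := 1 / 24) (by norm_num) (by norm_num)
    fun N => by
      obtain ⟨q, q', h, hN, hr⟩ := exists_isConsecutive_ratio hα (N + 100)
      have hle := h.mul_dist_le_one
      have hd := nearestDist_nonneg (q * α)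
      -- The level n ≈ 1.1q lies between q and q' ≥ 1.2q; the offset 100 absorbs rounding.
      refine ⟨11 * q / 10, by omega, q, by omega, ?_, ?_⟩
      · have : 21 * q ≤ 20 * (11 * q / 10) := by omega
        have : (21 : ℝ) * q ≤ 20 * (11 * q / 10 : ℕ) := by exact_mod_cast this
        linarith
      · have e : 24 * (11 * q / 10 + 1) ≤ 23 * q' := by omega
        have e' : (24 : ℝ) * ((11 * q / 10 : ℕ) + 1) ≤ 23 * q' := by exact_mod_cast e
        nlinarith
  filter_upwards [this] with t ht
  refine ht.trans_lt ?_
  rw [← ENNReal.ofReal_one]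
  exact (ENNReal.ofReal_lt_ofReal_iff one_pos).2 (by norm_num)

theorem ae_one_lt_upperRate (hα : Irrational α) (h0 : 0 < α) (h1 : α < 1)
    (hb : BadlyApproximable α) :
    ∀ᵐ t ∂lebesgueIco, 1 < upperRate (rotation α) (rotationPartition α) t := by
  obtain ⟨c, hc, hb⟩ := hb
  have := ae_le_upperRate hα h0 h1 (K := 12 / 11) (δ := c / 10) (by norm_num) (by positivity)
    fun N => by
      obtain ⟨q, q', h, hN, hr⟩ := exists_isConsecutive_ratio hα (N + 100)
      have hle := hb q (by omega)
      have hd := nearestDist_nonneg (q * α)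
      have hlt := h.lt
      -- Here n - q + 1 ≥ q/10, so q‖qα‖ ≥ c keeps the measure at least c/10.
      refine ⟨11 * q / 10, by omega, q, q', h, by omega, by omega, ?_, ?_⟩
      · have : 12 * (11 * q / 10) ≤ 11 * q' := by omega
        have : (12 : ℝ) * (11 * q / 10 : ℕ) ≤ 11 * q' := by exact_mod_cast this
        linarith
      · have e : 11 * q ≤ 10 * (11 * q / 10 + 1) := by omega
        have e' : (11 : ℝ) * q ≤ 10 * ((11 * q / 10 : ℕ) + 1) := by exact_mod_cast e
        nlinarith
  filter_upwards [this] with t ht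
  refine lt_of_lt_of_le ?_ ht
  rw [← ENNReal.ofReal_one]
  exact (ENNReal.ofReal_lt_ofReal_iff (by norm_num)).2 (by norm_num)

theorem ae_lowerRate_eq_zero (hα : Irrational α) (h0 : 0 < α) (h1 : α < 1)
    (hb : ¬BadlyApproximable α) :
    ∀ᵐ t ∂lebesgueIco, lowerRate (rotation α) (rotationPartition α) t = 0 := by
  have key : ∀ m : ℕ, ∀ᵐ t ∂lebesgueIco, lowerRate (rotation α) (rotationPartition α) t
      ≤ ENNReal.ofReal (1 / (m + 1)) := fun m =>
    ae_lowerRate_le hα h0 h1 (δ := 1 / 2) (by positivity) (by norm_num) fun N => by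
      set K : ℝ := 1 / (m + 1) with hK
      have hKpos : 0 < K := by positivity
      -- With n ≈ 1/(2θ) - 1, the bound 1/8 ensures n ≥ 1/(4θ), K/4 ensures k ≤ Kn, and the last
      -- bound ensures n ≥ N.
      obtain ⟨k, hk1, hk⟩ := exists_mul_nearestDist_lt hb
        (ε := min (1 / 8) (min (K / 4) (1 / (4 * (N + 1))))) (by positivity)
      obtain ⟨e1, hk'⟩ := lt_min_iff.1 hk
      obtain ⟨e2, e3⟩ := lt_min_iff.1 hk'
      have hθ := nearestDist_pos hα hk1
      set θ := nearestDist (k * α)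
      have hkr : (1 : ℝ) ≤ k := by exact_mod_cast hk1
      have hθ8 : θ < 1 / 8 := by nlinarith
      have hfl : (⌊1 / (2 * θ)⌋₊ : ℝ) ≤ 1 / (2 * θ) := Nat.floor_le (by positivity)
      have hfl' := Nat.lt_floor_add_one (1 / (2 * θ))
      have h4 : (4 : ℝ) ≤ 1 / (2 * θ) := by rw [le_div_iff₀ (by positivity)]; linarith
      have h1fl : 1 ≤ ⌊1 / (2 * θ)⌋₊ := (Nat.one_le_floor_iff _).2 (by linarith)
      have hn : 1 / (4 * θ) ≤ ((⌊1 / (2 * θ)⌋₊ - 1 : ℕ) : ℝ) := by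
        rw [Nat.cast_sub h1fl]
        have : 1 / (4 * θ) = 1 / (2 * θ) / 2 := by field_simp; norm_num
        push_cast
        linarith
      refine ⟨⌊1 / (2 * θ)⌋₊ - 1, ?_, k, hk1, ?_, ?_⟩
      · have : (N : ℝ) ≤ 1 / (4 * θ) := by
          rw [le_div_iff₀ (by positivity)]
          rw [lt_div_iff₀ (by positivity)] at e3
          nlinarith
        exact_mod_cast this.trans hn
      · calc (k : ℝ) ≤ K * (1 / (4 * θ)) := by
              rw [mul_one_div, le_div_iff₀ (by positivity)]; linarith
          _ ≤ _ := by gcongr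
      · rw [Nat.cast_sub h1fl]
        push_cast
        rw [le_div_iff₀ (by positivity)] at hfl
        linarith
  have hlim : Tendsto (fun m : ℕ => ENNReal.ofReal (1 / ((m : ℝ) + 1))) atTop (nhds 0) := by
    simpa using ENNReal.tendsto_ofReal (tendsto_one_div_add_atTop_nhds_zero_nat (𝕜 := ℝ))
  filter_upwards [ae_all_iff.2 key] with t ht
  exact le_antisymm (ge_of_tendsto' hlim ht) bot_le

theorem ae_upperRate_eq_top (hα : Irrational α) (h0 : 0 < α) (h1 : α < 1)
    (hb : ¬BadlyApproximable α) :
    ∀ᵐ t ∂lebesgueIco, upperRate (rotation α) (rotationPartition α) t = ⊤ := by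
  have key : ∀ m : ℕ, ∀ᵐ t ∂lebesgueIco, ENNReal.ofReal ((m + 1 : ℕ) : ℝ)
      ≤ upperRate (rotation α) (rotationPartition α) t := fun m =>
    ae_le_upperRate hα h0 h1 (δ := 1 / (4 * (m + 1 : ℕ))) (by positivity) (by positivity)
      fun N => by
      generalize hKdef : m + 1 = K
      have hK1 : 1 ≤ K := by omega
      have hKr : (1 : ℝ) ≤ K := by exact_mod_cast hK1
      obtain ⟨k, hk1, hk⟩ := exists_mul_nearestDist_lt hb
        (ε := min (1 / (4 * K)) (1 / (2 * K * (N + 1)))) (by positivity)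
      obtain ⟨e1, e2⟩ := lt_min_iff.1 hk
      obtain ⟨q, q', h, hqk, hkq', hmin⟩ := exists_isConsecutive hα hk1
      have hq := h.one_le
      have hd := hmin k hk1 le_rfl
      have hθ := nearestDist_pos hα hq
      have htwo := h.one_le_two_mul_dist
      have hqr : (1 : ℝ) ≤ q := by exact_mod_cast hq
      have hqkr : (q : ℝ) ≤ k := by exact_mod_cast hqk
      have hqθ : q * nearestDist (q * α) ≤ k * nearestDist (k * α) := by gcongr
      set θ := nearestDist (q * α)
      rw [lt_div_iff₀ (by positivity)] at e1 e2
      have hq' : (0 : ℝ) ≤ q' := Nat.cast_nonneg _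
      have f1 : q * θ * (4 * K) < 1 := lt_of_le_of_lt (by gcongr) e1
      have f2 : q * θ * (2 * K * (N + 1)) < 1 := lt_of_le_of_lt (by gcongr) e2
      have hqK : (q : ℝ) * (2 * K) ≤ q' := by
        by_contra! hc
        nlinarith
      have hdiv : (q' : ℝ) < K * ((q' / K : ℕ) + 1) := by
        exact_mod_cast Nat.lt_mul_div_succ q' (by omega)
      -- At n = ⌊q'/K⌋ one has n - q + 1 ≥ q'/(2K) because 2Kq ≤ q'; with q'θ ≥ 1/2 this gives
      -- measure at least 1/(4K).
      refine ⟨q' / K, ?_, q, q', h, ?_, ?_, ?_, ?_⟩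
      · rw [ge_iff_le, Nat.le_div_iff_mul_le (by omega)]
        have : (N : ℝ) * K ≤ q' := by
          have f3 : θ * (2 * K * (N + 1)) < 1 := by
            refine lt_of_le_of_lt ?_ f2
            have : 0 ≤ θ * (2 * K * (N + 1)) := by positivity
            nlinarith
          by_contra! hc
          nlinarith
        exact_mod_cast this
      · rw [Nat.le_div_iff_mul_le (by omega)]
        have : (q : ℝ) * K ≤ q' := by nlinarith
        exact_mod_cast this
      · have := Nat.div_le_self q' K
        omega
      · exact_mod_cast Nat.mul_div_le q' K
      · rw [div_le_iff₀ (by positivity)]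
        have g1 : (q' : ℝ) ≤ 2 * K * ((q' / K : ℕ) - q + 1) := by nlinarith
        calc (1 : ℝ) ≤ 2 * (q' * θ) := htwo
          _ ≤ 2 * (2 * K * ((q' / K : ℕ) - q + 1) * θ) := by gcongr
          _ = _ := by ring
  filter_upwards [ae_all_iff.2 key] with t ht
  refine ENNReal.eq_top_of_forall_nnreal_le fun r => ?_
  obtain ⟨m, hm⟩ := exists_nat_ge r
  refine le_trans ?_ (ht m)
  rw [ENNReal.ofReal_natCast]
  have : r ≤ ((m + 1 : ℕ) : NNReal) := hm.trans (by push_cast; simp)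
  exact_mod_cast this

end Rotation

end

/-! ### The Sturmian subshift as a coding of the rotation. -/

section

variable {α : ℝ}

section Coding

/-- The coding of a point, as a point of the Sturmian subshift. -/
noncomputable def codingPoint (α : ℝ) (t : UnitIco) : sturmianSet α :=
  ⟨coding α t, subset_closure ⟨t, rfl⟩⟩

/-- The zeroth letter of a point of the Sturmian subshift. -/
def zerothLetter (α : ℝ) (x : sturmianSet α) : Fin 2 := (x : ℤ → Fin 2) 0

theorem denseRange_codingPoint : DenseRange (codingPoint α) := by
  rw [DenseRange, Subtype.dense_iff, ← range_comp]
  exact subset_rfl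

theorem sturmianShift_codingPoint (t : UnitIco) :
    sturmianShift α (codingPoint α t) = codingPoint α (rotation α t) :=
  Subtype.ext (shift_coding α t)

theorem sturmianShift_iterate_codingPoint (k : ℕ) (t : UnitIco) :
    (sturmianShift α)^[k] (codingPoint α t) = codingPoint α ((rotation α)^[k] t) :=
  (Function.Semiconj.iterate_right (f := codingPoint α)
    (fun t => (sturmianShift_codingPoint t).symm) k t).symm

theorem sturmianShift_iterate_apply (k : ℕ) (x : sturmianSet α) (n : ℤ) :
    ((sturmianShift α)^[k] x : ℤ → Fin 2) n = (x : ℤ → Fin 2) (n + k) := by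
  induction k generalizing n with
  | zero => simp
  | succ k ih =>
    rw [Function.iterate_succ_apply']
    change ((sturmianShift α)^[k] x : ℤ → Fin 2) (n + 1) = _
    rw [ih]
    exact congrArg _ (by push_cast; ring)

theorem continuous_sturmianShift : Continuous (sturmianShift α) :=
  Continuous.subtype_mk (continuous_shift.comp continuous_subtype_val) _

theorem continuous_zerothLetter : Continuous (zerothLetter α) :=
  (continuous_apply 0).comp continuous_subtype_val

theorem measurable_zerothLetter : Measurable (zerothLetter α) :=
  continuous_zerothLetter.measurable

theorem measurable_sturmianShift : Measurable (sturmianShift α) :=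
  continuous_sturmianShift.measurable

theorem continuous_itinerary {X : Type*} [TopologicalSpace X] {T : X → X} {f : X → Fin 2}
    (hT : Continuous T) (hf : Continuous f) (n : ℕ) : Continuous (itinerary T f n) :=
  continuous_pi fun i => hf.comp (hT.iterate i)

theorem itinerary_codingPoint (n : ℕ) (t : UnitIco) :
    itinerary (sturmianShift α) (zerothLetter α) n (codingPoint α t)
      = itinerary (rotation α) (letter α) n t := by
  funext i
  simp only [itinerary, sturmianShift_iterate_codingPoint]
  simp [zerothLetter, codingPoint, coding]

/-- Two occurrences of w at distance k form an open condition, so a dense coding realizes it. -/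
theorem wordRecurrence_sturmianShift (n : ℕ) (w : Fin n → Fin 2) :
    wordRecurrence (sturmianShift α) (zerothLetter α) n w
      = wordRecurrence (rotation α) (letter α) n w := by
  apply le_antisymm
  · refine le_iInf₂ fun k hk => ?_
    obtain ⟨hk1, t, h, h'⟩ := hk
    refine wordRecurrence_le hk1 (y := codingPoint α t) ?_ ?_
    · rw [itinerary_codingPoint, h]
    · rw [sturmianShift_iterate_codingPoint, itinerary_codingPoint, h']
  · refine le_iInf₂ fun k hk => ?_
    obtain ⟨hk1, y, h, h'⟩ := hk
    have hc := continuous_itinerary (continuous_sturmianShift (α := α)) continuous_zerothLetter n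
    have ho : IsOpen {y | itinerary (sturmianShift α) (zerothLetter α) n y = w ∧
        itinerary (sturmianShift α) (zerothLetter α) n ((sturmianShift α)^[k] y) = w} :=
      ((isOpen_discrete {w}).preimage hc).inter
        ((isOpen_discrete {w}).preimage (hc.comp (continuous_sturmianShift.iterate k)))
    obtain ⟨t, ht, ht'⟩ := denseRange_codingPoint.exists_mem_open ho ⟨y, h, h'⟩
    rw [itinerary_codingPoint] at ht
    rw [sturmianShift_iterate_codingPoint, itinerary_codingPoint] at ht'
    exact wordRecurrence_le hk1 ht ht'

theorem sturmianPartition_eq :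
    sturmianPartition α = {{x | zerothLetter α x = 0}, {x | zerothLetter α x = 1}} := rfl

theorem lowerRate_sturmianShift (x : sturmianSet α) :
    lowerRate (sturmianShift α) (sturmianPartition α) x
      = liminf (fun n : ℕ => (wordRecurrence (rotation α) (letter α) n
          (itinerary (sturmianShift α) (zerothLetter α) n x) : ℝ≥0∞) / n) atTop := by
  rw [sturmianPartition_eq]
  simp only [lowerRate, setRecurrence_atomOf, wordRecurrence_sturmianShift]

theorem upperRate_sturmianShift (x : sturmianSet α) :
    upperRate (sturmianShift α) (sturmianPartition α) x
      = limsup (fun n : ℕ => (wordRecurrence (rotation α) (letter α) n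
          (itinerary (sturmianShift α) (zerothLetter α) n x) : ℝ≥0∞) / n) atTop := by
  rw [sturmianPartition_eq]
  simp only [upperRate, setRecurrence_atomOf, wordRecurrence_sturmianShift]

theorem lowerRate_codingPoint (t : UnitIco) :
    lowerRate (sturmianShift α) (sturmianPartition α) (codingPoint α t)
      = lowerRate (rotation α) (rotationPartition α) t := by
  simp only [lowerRate_sturmianShift, lowerRate_rotation, itinerary_codingPoint,
    rotationRecurrence]

theorem upperRate_codingPoint (t : UnitIco) :
    upperRate (sturmianShift α) (sturmianPartition α) (codingPoint α t)
      = upperRate (rotation α) (rotationPartition α) t := by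
  simp only [upperRate_sturmianShift, upperRate_rotation, itinerary_codingPoint,
    rotationRecurrence]

theorem measurable_wordRecurrence_itinerary (n : ℕ) :
    Measurable fun x : sturmianSet α => wordRecurrence (rotation α) (letter α) n
      (itinerary (sturmianShift α) (zerothLetter α) n x) :=
  (measurable_of_countable (wordRecurrence (rotation α) (letter α) n)).comp
    (measurable_itinerary measurable_sturmianShift measurable_zerothLetter n)

theorem measurable_lowerRate_sturmianShift :
    Measurable (lowerRate (sturmianShift α) (sturmianPartition α)) := by
  rw [funext lowerRate_sturmianShift]
  exact .liminf (measurable_coe_div measurable_wordRecurrence_itinerary)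

theorem measurable_upperRate_sturmianShift :
    Measurable (upperRate (sturmianShift α) (sturmianPartition α)) := by
  rw [funext upperRate_sturmianShift]
  exact .limsup (measurable_coe_div measurable_wordRecurrence_itinerary)

theorem measurable_rotation_zpow (n : ℤ) : Measurable ⇑(rotation α ^ n) := by
  cases n with
  | ofNat n =>
    rw [Int.ofNat_eq_natCast, zpow_natCast, ← Equiv.Perm.iterate_eq_pow]
    exact measurable_rotation.iterate n
  | negSucc n =>
    rw [zpow_negSucc, ← inv_pow, ← Equiv.Perm.iterate_eq_pow]
    refine Measurable.iterate ?_ _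
    exact Measurable.subtype_mk (measurable_fract.comp (measurable_subtype_coe.sub_const α))

theorem measurable_codingPoint : Measurable (codingPoint α) :=
  Measurable.subtype_mk (measurable_pi_lambda _ fun n =>
    measurable_letter.comp (measurable_rotation_zpow n))

/-- The image of Lebesgue measure on the Sturmian subshift. -/
noncomputable def sturmianMeasure (α : ℝ) : Measure (sturmianSet α) :=
  lebesgueIco.map (codingPoint α)

theorem measurePreserving_codingPoint :
    MeasurePreserving (codingPoint α) lebesgueIco (sturmianMeasure α) :=
  ⟨measurable_codingPoint, rfl⟩

instance : IsProbabilityMeasure (sturmianMeasure α) :=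
  Measure.isProbabilityMeasure_map measurable_codingPoint.aemeasurable

theorem ergodic_sturmianShift (hα : Irrational α) :
    Ergodic (sturmianShift α) (sturmianMeasure α) :=
  measurePreserving_codingPoint.ergodic_of_ergodic_semiconj (ergodic_rotation hα)
    measurable_sturmianShift fun t => (sturmianShift_codingPoint t).symm

end Coding

/-! ### Unique ergodicity. -/

section UniqueErgodicity

theorem exists_nat_mem_Ico (hα : Irrational α) {a ε : ℝ} (hε : 0 < ε) :
    ∃ k : ℕ, ∃ m : ℤ, k * α - m ∈ Ico a (a + ε) := by
  obtain ⟨q, q', h, -, hn, -⟩ := exists_isConsecutive hα (n := ⌈2 / ε⌉₊ + 1) (by omega)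
  have h1 := h.mul_dist_le_one
  have h2 := h.dist_lt
  have h3 := nearestDist_nonneg (q * α)
  have h4 : 2 / ε ≤ q' := (Nat.le_ceil _).trans (by exact_mod_cast (by omega))
  rw [div_le_iff₀ hε] at h4
  have h5 : nearestDist (q * α) + nearestDist (q' * α) ≤ -a - (-(a + ε)) := by
    have h6 : 2 * nearestDist (q * α) ≤ ε := by
      by_contra! hc
      have hq' : (0 : ℝ) < q' := by
        have := h.lt
        exact_mod_cast (by omega : 0 < q')
      nlinarith
    linarith
  obtain ⟨i, -, -, m, hm1, hm2⟩ := h.exists_mem_Ioc hα h5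
  exact ⟨i, m, by linarith, by linarith⟩

/-- Equidistributed translates meet an interval in the expected number of points, up to `2`. -/
theorem card_filter_mem_Icc_le {M : ℕ} (hM : 1 ≤ M) {k : ℕ → ℕ} {m : ℕ → ℤ}
    (hk : ∀ i : ℕ, k i * α - m i ∈ Ico ((i : ℝ) / M) ((i : ℝ) / M + 1 / M)) {a b : ℝ} (hab : a ≤ b)
    (t : UnitIco) :
    (((Finset.range M).filter fun i =>
      (((rotation α)^[k i] t : UnitIco) : ℝ) ∈ Icc a b).card : ℝ) ≤ (b - a) * M + 2 := by
  have hMpos : (0 : ℝ) < M := by exact_mod_cast hM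
  choose z hz using fun i => exists_int_rotation_iterate (α := α) (k i) t
  -- F lifts i to an integer approximating M times the displacement. It is injective on i < M by
  -- reduction mod M, so it suffices to count integers in an interval.
  set F : ℕ → ℤ := fun i => i - M * (z i - m i) with hF
  have hcard : ((Finset.range M).filter fun i =>
      (((rotation α)^[k i] t : UnitIco) : ℝ) ∈ Icc a b).card
      ≤ (Finset.Ioc ⌊M * (a - t) - 1⌋ ⌊M * (b - t)⌋).card := by
    refine Finset.card_le_card_of_injOn F ?_ ?_
    · intro i hi
      simp only [Finset.coe_filter, Finset.mem_range, mem_ofPred_eq] at hi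
      obtain ⟨-, hia, hib⟩ := hi
      obtain ⟨h1, h2⟩ := hk i
      rw [hz] at hia hib
      rw [← add_div, lt_div_iff₀ hMpos] at h2
      rw [div_le_iff₀ hMpos] at h1
      have e : (F i : ℝ) = i - M * (z i - m i) := by simp [hF]
      rw [Finset.coe_Ioc, mem_Ioc, Int.floor_lt, Int.le_floor, e]
      constructor <;> nlinarith
    · intro i hi j hj hij
      simp only [Finset.coe_filter, Finset.mem_range, mem_ofPred_eq] at hi hj
      have hi1 := hi.1
      have hj1 := hj.1
      simp only [hF] at hij
      have e : (i : ℤ) - j = M * ((z i - m i) - (z j - m j)) := by linear_combination hij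
      have hd : (M : ℤ) ∣ (i : ℤ) - j := ⟨_, e⟩
      have := Int.eq_zero_of_abs_lt_dvd hd (by rw [abs_lt]; constructor <;> omega)
      omega
  have h1 := Int.floor_le (M * (b - t))
  have h2 := Int.lt_floor_add_one (M * (a - t) - 1)
  have h3 : ((Finset.Ioc ⌊M * (a - t) - 1⌋ ⌊M * (b - t)⌋).card : ℝ) ≤ (b - a) * M + 2 := by
    rw [Int.card_Ioc]
    rcases le_total 0 (⌊M * (b - t)⌋ - ⌊M * (a - t) - 1⌋) with h | h
    · have : (((⌊M * (b - t)⌋ - ⌊M * (a - t) - 1⌋).toNat : ℤ) : ℝ)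
          = ((⌊M * (b - t)⌋ - ⌊M * (a - t) - 1⌋ : ℤ) : ℝ) := by rw [Int.toNat_of_nonneg h]
      rw [Int.cast_natCast] at this
      rw [this]
      push_cast
      linarith
    · rw [Int.toNat_of_nonpos h]
      have : 0 ≤ (b - a) * M := mul_nonneg (by linarith) hMpos.le
      push_cast
      linarith
  exact le_trans (by exact_mod_cast hcard) h3

/-- The points with a given itinerary lie in a closed interval of the same measure. -/
theorem exists_Icc_of_itinerary (h0 : 0 < α) (h1 : α < 1) {n : ℕ} {w : Fin n → Fin 2}
    (hw : ∃ t, itinerary (rotation α) (letter α) n t = w) :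
    ∃ a b : ℝ, a ≤ b ∧ (∀ t, itinerary (rotation α) (letter α) n t = w → (t : ℝ) ∈ Icc a b) ∧
      ENNReal.ofReal (b - a) ≤ lebesgueIco {t | itinerary (rotation α) (letter α) n t = w} := by
  set J : Set ℝ := Subtype.val '' {t | itinerary (rotation α) (letter α) n t = w} with hJ
  have hne : J.Nonempty := by
    obtain ⟨t, ht⟩ := hw
    exact ⟨t, t, ht, rfl⟩
  have hbdd : BddBelow J := ⟨0, by rintro _ ⟨t, -, rfl⟩; exact t.2.1⟩
  have hbdd' : BddAbove J := ⟨1, by rintro _ ⟨t, -, rfl⟩; exact t.2.2.le⟩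
  refine ⟨sInf J, sSup J, csInf_le_csSup hne hbdd hbdd', fun t ht =>
    ⟨csInf_le hbdd ⟨t, ht, rfl⟩, le_csSup hbdd' ⟨t, ht, rfl⟩⟩, ?_⟩
  rw [lebesgueIco_apply, ← Real.volume_Ioo]
  refine measure_mono fun x ⟨hx1, hx2⟩ => ?_
  obtain ⟨_, ⟨s, hs, rfl⟩, hsx⟩ := exists_lt_of_csInf_lt hne hx1
  obtain ⟨_, ⟨u, hu, rfl⟩, hxu⟩ := exists_lt_of_lt_csSup hne hx2
  simp only [mem_ofPred_eq] at hs hu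
  have hx : x ∈ Ico (0 : ℝ) 1 := ⟨s.2.1.trans hsx.le, hxu.trans u.2.2⟩
  exact ⟨⟨x, hx⟩, (itinerary_eq_of_mem_Icc h0 h1 (hs.trans hu.symm) (u := ⟨x, hx⟩)
    hsx.le hxu.le).symm.trans hs, rfl⟩

theorem measure_itinerary_le (hα : Irrational α) (h0 : 0 < α) (h1 : α < 1)
    {ν : Measure (sturmianSet α)} [IsProbabilityMeasure ν]
    (hν : MeasurePreserving (sturmianShift α) ν ν) (n : ℕ) (w : Fin n → Fin 2) :
    ν {x | itinerary (sturmianShift α) (zerothLetter α) n x = w}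
      ≤ lebesgueIco {t | itinerary (rotation α) (letter α) n t = w} := by
  have hc := continuous_itinerary (continuous_sturmianShift (α := α)) continuous_zerothLetter n
  have hm := measurable_itinerary (measurable_sturmianShift (α := α)) measurable_zerothLetter n
  set D := {x | itinerary (sturmianShift α) (zerothLetter α) n x = w} with hD
  have hDm : MeasurableSet D := hm (measurableSet_singleton w)
  by_cases hw : ∃ t, itinerary (rotation α) (letter α) n t = w
  swap
  · have hempty : D = ∅ := by
      by_contra hne
      obtain ⟨t, ht⟩ := denseRange_codingPoint.exists_mem_open
        ((isOpen_discrete {w}).preimage hc) (nonempty_iff_ne_empty.2 hne)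
      exact hw ⟨t, by rwa [mem_preimage, itinerary_codingPoint] at ht⟩
    rw [hempty, measure_empty]
    exact bot_le
  obtain ⟨a, b, hab, hJ, hvol⟩ := exists_Icc_of_itinerary h0 h1 hw
  refine le_trans ?_ hvol
  -- By invariance the left side is the integral of the number of visits to D at M well-spread
  -- times. The count is bounded on codings and, by continuity, on the whole subshift.
  have key : ∀ M : ℕ, 1 ≤ M → M * ν.real D ≤ (b - a) * M + 2 := by
    intro M hM
    have hMpos : (0 : ℝ) < M := by exact_mod_cast hM
    choose k m hk using fun i : ℕ =>
      exists_nat_mem_Ico hα (a := (i : ℝ) / M) (ε := 1 / M) (by positivity)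
    set c : (Fin n → Fin 2) → ℝ := fun v => if v = w then 1 else 0 with hcdef
    set F : sturmianSet α → ℝ := fun x => ∑ i ∈ Finset.range M,
      c (itinerary (sturmianShift α) (zerothLetter α) n ((sturmianShift α)^[k i] x)) with hFdef
    have hFc : Continuous F := continuous_finsetSum _ fun i _ =>
      (continuous_of_discreteTopology (f := c)).comp
        (hc.comp (continuous_sturmianShift.iterate (k i)))
    have hF : ∀ x, F x ≤ (b - a) * M + 2 := by
      intro x
      refine denseRange_codingPoint.induction_on (p := fun x => F x ≤ (b - a) * M + 2) x
        (isClosed_le hFc continuous_const) fun t => ?_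
      refine le_trans ?_ (card_filter_mem_Icc_le hM hk hab t)
      simp only [hFdef, hcdef, sturmianShift_iterate_codingPoint, itinerary_codingPoint,
        Finset.sum_boole]
      gcongr with i
      exact hJ _
    have hterm : ∀ i, (fun x => c (itinerary (sturmianShift α) (zerothLetter α) n
        ((sturmianShift α)^[k i] x))) = ((sturmianShift α)^[k i] ⁻¹' D).indicator 1 := by
      intro i
      funext x
      simp only [hcdef, indicator, mem_preimage, hD, mem_ofPred_eq, Pi.one_apply]
    have hDi : ∀ i, MeasurableSet ((sturmianShift α)^[k i] ⁻¹' D) := fun i =>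
      (measurable_sturmianShift.iterate (k i)) hDm
    have hint : ∫ x, F x ∂ν = M * ν.real D := by
      simp only [hFdef]
      rw [integral_finsetSum]
      · have : ∀ i ∈ Finset.range M, ∫ x, c (itinerary (sturmianShift α) (zerothLetter α) n
            ((sturmianShift α)^[k i] x)) ∂ν = ν.real D := by
          intro i _
          rw [hterm, integral_indicator_one (hDi i), measureReal_def,
            (hν.iterate (k i)).measure_preimage hDm.nullMeasurableSet, measureReal_def]
        rw [Finset.sum_congr rfl this, Finset.sum_const, Finset.card_range, nsmul_eq_mul]
      · intro i _
        rw [hterm]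
        exact (integrable_const (1 : ℝ)).indicator (hDi i)
    rw [← hint]
    have hFi : Integrable F ν := by
      refine integrable_finsetSum _ fun i _ => ?_
      rw [hterm]
      exact (integrable_const (1 : ℝ)).indicator (hDi i)
    calc ∫ x, F x ∂ν ≤ ∫ _, ((b - a) * M + 2) ∂ν := integral_mono hFi (integrable_const _) hF
      _ = _ := by simp
  have hle : ν.real D ≤ b - a := by
    by_contra! hlt
    obtain ⟨M, hM⟩ := exists_nat_gt (2 / (ν.real D - (b - a)))
    have hpos : 0 < ν.real D - (b - a) := by linarith
    have hM0 : (0 : ℝ) < M := lt_trans (by positivity) hM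
    rw [div_lt_iff₀ hpos] at hM
    have := key M (by exact_mod_cast hM0)
    nlinarith
  rw [← ofReal_measureReal]
  exact ENNReal.ofReal_le_ofReal hle

theorem map_itinerary_eq (hα : Irrational α) (h0 : 0 < α) (h1 : α < 1)
    {ν : Measure (sturmianSet α)} [IsProbabilityMeasure ν]
    (hν : MeasurePreserving (sturmianShift α) ν ν) (n : ℕ) :
    ν.map (itinerary (sturmianShift α) (zerothLetter α) n)
      = (sturmianMeasure α).map (itinerary (sturmianShift α) (zerothLetter α) n) := by
  have hm := measurable_itinerary (measurable_sturmianShift (α := α)) measurable_zerothLetter n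
  have := Measure.isProbabilityMeasure_map (μ := ν) hm.aemeasurable
  have := Measure.isProbabilityMeasure_map (μ := sturmianMeasure α) hm.aemeasurable
  -- One inequality suffices, since both measures have total mass 1.
  refine Measure.eq_of_le_of_isProbabilityMeasure (Measure.le_iff'.2 fun s => ?_)
  have hs := s.toFinite.coe_toFinset
  rw [← hs, ← sum_measure_singleton, ← sum_measure_singleton]
  refine Finset.sum_le_sum fun w _ => ?_
  rw [Measure.map_apply hm (measurableSet_singleton w),
    Measure.map_apply hm (measurableSet_singleton w), sturmianMeasure,
    Measure.map_apply measurable_codingPoint (hm (measurableSet_singleton w))]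
  refine (measure_itinerary_le hα h0 h1 hν n w).trans (le_of_eq ?_)
  congr 1
  ext t
  simp only [mem_ofPred_eq, mem_preimage, itinerary_codingPoint, mem_singleton_iff]

theorem eq_sturmianMeasure (hα : Irrational α) (h0 : 0 < α) (h1 : α < 1)
    {ν : Measure (sturmianSet α)} [IsProbabilityMeasure ν]
    (hν : MeasurePreserving (sturmianShift α) ν ν) : ν = sturmianMeasure α := by
  have hemb : MeasurableEmbedding (Subtype.val : sturmianSet α → ℤ → Fin 2) :=
    MeasurableEmbedding.subtype_coe isClosed_closure.measurableSet
  refine hemb.map_injective ?_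
  refine IsProjectiveLimit.unique (P := fun I =>
    ((sturmianMeasure α).map (Subtype.val : sturmianSet α → ℤ → Fin 2)).map I.restrict)
    (fun I => ?_) fun I => rfl
  obtain ⟨N, hN⟩ : ∃ N : ℕ, ∀ i ∈ I, |i| < N := by
    refine ⟨I.sup Int.natAbs + 1, fun i hi => ?_⟩
    rw [Int.abs_eq_natAbs]
    exact_mod_cast Nat.lt_succ_of_le (Finset.le_sup (f := Int.natAbs) hi)
  set n := 2 * N
  have hm := measurable_itinerary (measurable_sturmianShift (α := α)) measurable_zerothLetter n
  have hr : Measurable (I.restrict : (ℤ → Fin 2) → I → Fin 2) := Finset.measurable_restrict I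
  -- Shifting by N turns the two-sided coordinates |i| < N into letters of a forward word of length
  -- 2N; invariance makes the shift harmless.
  set H : (Fin n → Fin 2) → I → Fin 2 := fun w i => w ⟨((i : ℤ) + N).toNat, by
    have := abs_lt.1 (hN i i.2)
    omega⟩ with hH
  have hHm : Measurable H := measurable_of_countable _
  have hfac : I.restrict ∘ (Subtype.val : sturmianSet α → ℤ → Fin 2) ∘ (sturmianShift α)^[N]
      = H ∘ itinerary (sturmianShift α) (zerothLetter α) n := by
    funext x i
    have := abs_lt.1 (hN i i.2)
    simp only [Function.comp_apply, Finset.restrict_def, hH, itinerary, zerothLetter,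
      sturmianShift_iterate_apply]
    exact congrArg _ (by omega)
  have main : ∀ ρ : Measure (sturmianSet α), MeasurePreserving (sturmianShift α) ρ ρ →
      (ρ.map (Subtype.val : sturmianSet α → ℤ → Fin 2)).map I.restrict
        = (ρ.map (itinerary (sturmianShift α) (zerothLetter α) n)).map H := by
    intro ρ hρ
    rw [Measure.map_map hHm hm, ← hfac, Measure.map_map hr measurable_subtype_coe]
    conv_lhs => rw [← (hρ.iterate N).map_eq]
    rw [Measure.map_map (hr.comp measurable_subtype_coe) (hρ.iterate N).measurable]
    rfl
  rw [main ν hν, map_itinerary_eq hα h0 h1 hν n]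
  exact (main _ (ergodic_sturmianShift hα).toMeasurePreserving).symm

theorem isUniqueErgodicMeasure_sturmianMeasure (hα : Irrational α) (h0 : 0 < α) (h1 : α < 1) :
    IsUniqueErgodicMeasure (sturmianShift α) (sturmianMeasure α) :=
  ⟨inferInstance, ergodic_sturmianShift hα, fun _ _ hν => eq_sturmianMeasure hα h0 h1 hν⟩

end UniqueErgodicity

/-! ### Transfer of the rates and conclusion. -/

section Transfer

theorem ae_sturmianMeasure_iff {p : sturmianSet α → Prop} (hp : MeasurableSet {x | p x}) :
    (∀ᵐ x ∂sturmianMeasure α, p x) ↔ ∀ᵐ t ∂lebesgueIco, p (codingPoint α t) :=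
  ae_map_iff measurable_codingPoint.aemeasurable hp

theorem ae_lowerRate_pos_iff :
    (∀ᵐ x ∂sturmianMeasure α, 0 < lowerRate (sturmianShift α) (sturmianPartition α) x) ↔
      ∀ᵐ t ∂lebesgueIco, 0 < lowerRate (rotation α) (rotationPartition α) t := by
  rw [ae_sturmianMeasure_iff (measurableSet_lt measurable_const measurable_lowerRate_sturmianShift)]
  simp only [lowerRate_codingPoint]

theorem ae_upperRate_lt_top_iff :
    (∀ᵐ x ∂sturmianMeasure α, upperRate (sturmianShift α) (sturmianPartition α) x < ⊤) ↔
      ∀ᵐ t ∂lebesgueIco, upperRate (rotation α) (rotationPartition α) t < ⊤ := by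
  rw [ae_sturmianMeasure_iff (measurableSet_lt measurable_upperRate_sturmianShift measurable_const)]
  simp only [upperRate_codingPoint]

theorem ae_lowerRate_lt_one_iff :
    (∀ᵐ x ∂sturmianMeasure α, lowerRate (sturmianShift α) (sturmianPartition α) x < 1) ↔
      ∀ᵐ t ∂lebesgueIco, lowerRate (rotation α) (rotationPartition α) t < 1 := by
  rw [ae_sturmianMeasure_iff (measurableSet_lt measurable_lowerRate_sturmianShift measurable_const)]
  simp only [lowerRate_codingPoint]

theorem ae_one_lt_upperRate_iff :
    (∀ᵐ x ∂sturmianMeasure α, 1 < upperRate (sturmianShift α) (sturmianPartition α) x) ↔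
      ∀ᵐ t ∂lebesgueIco, 1 < upperRate (rotation α) (rotationPartition α) t := by
  rw [ae_sturmianMeasure_iff (measurableSet_lt measurable_const measurable_upperRate_sturmianShift)]
  simp only [upperRate_codingPoint]

end Transfer

theorem rotation_tfae (hα : Irrational α) (h0 : 0 < α) (h1 : α < 1) :
    List.TFAE [BoundedCoefficients α,
      ∀ᵐ t ∂lebesgueIco, 0 < lowerRate (rotation α) (rotationPartition α) t,
      ∀ᵐ t ∂lebesgueIco, upperRate (rotation α) (rotationPartition α) t < ⊤] := by
  rw [boundedCoefficients_iff hα]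
  tfae_have 1 → 2 := fun hb => Eventually.of_forall (lowerRate_pos_of_bounded hα h0 h1 hb)
  tfae_have 1 → 3 := fun hb => Eventually.of_forall (upperRate_lt_top_of_bounded h0 h1 hb)
  tfae_have 2 → 1 := fun h => by
    by_contra hb
    obtain ⟨t, ht, ht'⟩ := (h.and (ae_lowerRate_eq_zero hα h0 h1 hb)).exists
    exact ht.ne' ht'
  tfae_have 3 → 1 := fun h => by
    by_contra hb
    obtain ⟨t, ht, ht'⟩ := (h.and (ae_upperRate_eq_top hα h0 h1 hb)).exists
    exact ht.ne ht'
  tfae_finish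

end

end Recurrence

theorem mainTheorem2 (α : ℝ) (hα : Irrational α) (h0 : 0 < α) (h1 : α < 1) :
    (∃ μ : Measure (Recurrence.sturmianSet α),
      Recurrence.IsUniqueErgodicMeasure (Recurrence.sturmianShift α) μ ∧
      List.TFAE [
        Recurrence.BoundedCoefficients α,
        ∀ᵐ x ∂μ, 0 < Recurrence.lowerRate (Recurrence.sturmianShift α)
          (Recurrence.sturmianPartition α) x,
        ∀ᵐ x ∂μ, Recurrence.upperRate (Recurrence.sturmianShift α)
          (Recurrence.sturmianPartition α) x < ⊤] ∧
      (Recurrence.BoundedCoefficients α →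
        (∀ᵐ x ∂μ, Recurrence.lowerRate (Recurrence.sturmianShift α)
          (Recurrence.sturmianPartition α) x < 1) ∧
        (∀ᵐ x ∂μ, 1 < Recurrence.upperRate (Recurrence.sturmianShift α)
          (Recurrence.sturmianPartition α) x))) ∧
    List.TFAE [
      Recurrence.BoundedCoefficients α,
      ∀ᵐ t ∂ Recurrence.lebesgueIco, 0 < Recurrence.lowerRate (Recurrence.rotation α)
        (Recurrence.rotationPartition α) t,
      ∀ᵐ t ∂ Recurrence.lebesgueIco, Recurrence.upperRate (Recurrence.rotation α)
        (Recurrence.rotationPartition α) t < ⊤] ∧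
    (Recurrence.BoundedCoefficients α →
      (∀ᵐ t ∂ Recurrence.lebesgueIco, Recurrence.lowerRate (Recurrence.rotation α)
        (Recurrence.rotationPartition α) t < 1) ∧
      (∀ᵐ t ∂ Recurrence.lebesgueIco, 1 < Recurrence.upperRate (Recurrence.rotation α)
        (Recurrence.rotationPartition α) t)) := by
  have hT := Recurrence.rotation_tfae hα h0 h1
  have hB := fun hb : Recurrence.BoundedCoefficients α =>
    And.intro (Recurrence.ae_lowerRate_lt_one hα h0 h1)
      (Recurrence.ae_one_lt_upperRate hα h0 h1 (hb.badlyApproximable hα))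
  refine ⟨⟨Recurrence.sturmianMeasure α,
    Recurrence.isUniqueErgodicMeasure_sturmianMeasure hα h0 h1, ?_, ?_⟩, hT, hB⟩
  · rwa [Recurrence.ae_lowerRate_pos_iff, Recurrence.ae_upperRate_lt_top_iff]
  · rwa [Recurrence.ae_lowerRate_lt_one_iff, Recurrence.ae_one_lt_upperRate_iff]
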